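/- Let $\mathcal H$ be a complex Hilbert space, $H_0$ a (possibly unbounded) self-adjoint operator in $\mathcal H$ with domain $\mathcal D(H_0)$, and $t\mapsto V(t)$, $t\in\mathbb R$, a strongly continuous family of bounded (not necessarily self-adjoint) operators on $\mathcal H$. Consider $$\frac{d\varphi}{dt}=-i\,(H_0+V(t))\,\varphi+f(t),\qquad f:\mathbb R\to\mathcal H\ \text{continuous and bounded}.\tag{1}$$ A weak solution of (1) on $J\subseteq\mathbb R$ is a function $x$ such that, for every $\eta\in \mathcal D(H_0)$ and every $t\in J$, $(\eta,x(\cdot))$ is differentiable at $t$ with $$\tfrac{d}{dt}(\eta,x(t))=-i(H_0\eta,x(t))-i(\eta,V(t)x(t))+(\eta,f(t)).$$ Let $U(t,s)=e^{-itH_0}\tilde U(t,s)e^{isH_0}$, $t,s\in\mathbb R$, be the evolution family of the homogeneous equation, where $\tilde U(t,s)$ is the sum of the Dyson series of $\tilde V(t)=e^{itH_0}V(t)e^{-itH_0}$. An exponential dichotomy of $U$ on an interval $J$ with bounded projections $P(t)$ ($P(t)^2=P(t)$, not necessarily orthogonal) means: $U(t,s)P(s)=P(t)U(t,s)$ and,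 for some constants $M$ and $\alpha>0$, $$\|U(t,s)P(s)\|\le Me^{-\alpha(t-s)},\qquad \|U(s,t)(I-P(t))\|\le Me^{-\alpha(t-s)},\qquad s\le t,\ s,t\in J.$$ **Theorem.** Suppose that $U$ has an exponential dichotomy on $[0,\infty)$ with projections $P_+(t)$ and on $(-\infty,0]$ with projections $P_-(t)$, and that $D=P_+(0)-(I-P_-(0))$ is generalized-invertible, i.e. $DXD=D$ for some bounded $X$. Let $D^+$ be the Moore–Penrose pseudoinverse of $D$, $\mathcal P_{N(D)}=I-D^+D$, $\mathcal P_{N(D^*)}=I-DD^+$, and $H(t)=\mathcal P_{N(D^*)}P_-(0)U(0,t)$. Put $$g=\int_0^{\infty}U(0,\tau)(I-P_+(\tau))f(\tau)\,d\tau+\int_{-\infty}^0U(0,\tau)P_-(\tau)f(\tau)\,d\tau ,$$ $$(G[f])(t,0)=\int_0^tU(t,\tau)P_+(\tau)f(\tau)\,d\tau-\int_t^{\infty}U(t,\tau)(I-P_+(\tau))f(\tau)\,d\tau+U(t,0)P_+(0)D^+g\quad(t\ge0),$$ $$(G[f])(t,0)=\int_{-\infty}^tU(t,\tau)P_-(\tau)f(\tau)\,d\tau-\int_t^0U(t,\tau)(I-P_-(\tau))f(\tau)\,d\tau+U(t,0)(I-P_-(0))D^+g\quad(t\le0),$$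 where at $t=0$ the first formula is used (by assertion 2 the two formulas agree there under condition (2)). All improper integrals here and below converge absolutely, and the following holds. 1. Equation (1) has a weak solution on $\mathbb R$ that is bounded on $\mathbb R$ if and only if $$\int_{-\infty}^{+\infty}H(t)f(t)\,dt=0.\tag{2}$$ 2. If (2) holds, the weak solutions of (1) on $\mathbb R$ that are bounded on $\mathbb R$ are exactly the functions $$x_0(t,c)=U(t,0)P_+(0)\mathcal P_{N(D)}c+(G[f])(t,0),\qquad c\in\mathcal H;$$ the two formulas for $(G[f])(0,0)$ agree, and $(G[f])(\cdot,0)$ is itself a weak solution of (1) on $\mathbb R$. 3. Whether or not (2) holds, $(G[f])(\cdot,0)$ is a weak solution of (1) on $\mathbb R\setminus\{0\}$, has one-sided limits at $0$, and $$(G[f])(0+,0)-(G[f])(0-,0)=-\int_{-\infty}^{+\infty}H(t)f(t)\,dt .$$ -/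

import Mathlib

open MeasureTheory Filter Topology Set
open scoped BoundedContinuousFunction

noncomputable section

namespace SchrodingerDichotomy

variable {E : Type*} [NormedAddCommGroup E] [InnerProductSpace ℂ E] [CompleteSpace E]

/-- `W t = e^{-itA}`: the strongly continuous one-parameter unitary group whose infinitesimal
generator is exactly `-iA` (domains included).  For self-adjoint `A` it is unique. -/
structure IsUnitaryGroupOf (A : E →ₗ.[ℂ] E) (W : ℝ → E →L[ℂ] E) : Prop where
  unitary : ∀ t, W t ∈ unitary (E →L[ℂ] E)
  map_zero : W 0 = 1
  map_add : ∀ s t, W (s + t) = W s * W t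
  continuous : ∀ ψ, Continuous fun t => W t ψ
  generator : ∀ ψ ψ' : E, HasDerivAt (fun t => W t ψ) ψ' 0 ↔
    ∃ h : ψ ∈ A.domain, ψ' = -Complex.I • A ⟨ψ, h⟩

/-- The perturbation in the interaction picture, `e^{itA} V(t) e^{-itA}`, where `W t = e^{-itA}`. -/
def interaction (W V : ℝ → E →L[ℂ] E) (t : ℝ) : E →L[ℂ] E :=
  W (-t) * V t * W t

/-- The `n`-th term of the Dyson series applied to `ψ`:
`(-i)^n ∫_s^t ∫_s^{t₁} ⋯ ∫_s^{tₙ₋₁} Ṽ(t₁) ⋯ Ṽ(tₙ) ψ dtₙ ⋯ dt₁`. -/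
def dysonTerm (W V : ℝ → E →L[ℂ] E) (s : ℝ) (ψ : E) : ℕ → ℝ → E
  | 0, _ => ψ
  | n + 1, t => -Complex.I • ∫ τ in s..t, interaction W V τ (dysonTerm W V s ψ n τ)

/-- `U(t,s) = e^{-itH₀} Ũ(t,s) e^{isH₀}` for all real `t, s`, where `Ũ` is the Dyson propagator of
`Ṽ(t) = e^{itH₀} V(t) e^{-itH₀}`: the family of evolution operators of `φ' = -i (H₀ + V(t)) φ`. -/
def IsEvolutionFamily (H₀ : E →ₗ.[ℂ] E) (V : ℝ → E →L[ℂ] E) (U : ℝ → ℝ → E →L[ℂ] E) : Prop :=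
  ∃ W : ℝ → E →L[ℂ] E, IsUnitaryGroupOf H₀ W ∧
    ∀ t s ψ, U t s ψ = W t (∑' n, dysonTerm W V s (W (-s) ψ) n t)

/-- `x` satisfies `x' = -i (H₀ + V(t)) x + f(t)` weakly at every point of `J`. -/
def IsWeakSolutionOn (H₀ : E →ₗ.[ℂ] E) (V : ℝ → E →L[ℂ] E) (f : ℝ → E) (x : ℝ → E)
    (J : Set ℝ) : Prop :=
  ∀ η : H₀.domain, ∀ t ∈ J, HasDerivAt (fun τ => inner ℂ (η : E) (x τ))
    (-Complex.I * inner ℂ (H₀ η) (x t) - Complex.I * inner ℂ (η : E) (V t (x t))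
      + inner ℂ (η : E) (f t)) t

/-- A weak solution on the entire line which is bounded there. -/
def IsBoundedWeakSolution (H₀ : E →ₗ.[ℂ] E) (V : ℝ → E →L[ℂ] E) (f : ℝ → E) (x : ℝ → E) :
    Prop :=
  IsWeakSolutionOn H₀ V f x univ ∧ ∃ C : ℝ, ∀ t, ‖x t‖ ≤ C

/-- Exponential dichotomy of `U` on the interval `J` with projections `P t`, `t ∈ J`
(only the values of `P` on `J` matter; the projections need not be orthogonal). -/
structure HasExpDichotomyOn (U : ℝ → ℝ → E →L[ℂ] E) (J : Set ℝ) (P : ℝ → E →L[ℂ] E) :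
    Prop where
  idem : ∀ t ∈ J, P t * P t = P t
  comm : ∀ t ∈ J, ∀ s ∈ J, s ≤ t → U t s * P s = P t * U t s
  bound : ∃ M α : ℝ, 0 < α ∧ ∀ t ∈ J, ∀ s ∈ J, s ≤ t →
    ‖U t s * P s‖ ≤ M * Real.exp (-α * (t - s)) ∧
    ‖U s t * (1 - P t)‖ ≤ M * Real.exp (-α * (t - s))

/-- Existence of a bounded generalized (inner) inverse. -/
def IsGeneralizedInvertible (D : E →L[ℂ] E) : Prop :=
  ∃ X : E →L[ℂ] E, D * X * D = D

/-- The four Penrose equations. -/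
structure IsMoorePenroseInverse (D X : E →L[ℂ] E) : Prop where
  mul_mul : D * X * D = D
  mul_mul' : X * D * X = X
  selfAdjoint_left : IsSelfAdjoint (D * X)
  selfAdjoint_right : IsSelfAdjoint (X * D)

open Classical in
/-- The Moore–Penrose pseudoinverse `D⁺` (the value `0` if there is none). -/
def pinv (D : E →L[ℂ] E) : E →L[ℂ] E :=
  if h : ∃ X, IsMoorePenroseInverse D X then h.choose else 0

/-- `𝒫_{N(D)} = I - D⁺ D`. -/
def projKer (D : E →L[ℂ] E) : E →L[ℂ] E := 1 - pinv D * D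

/-- `𝒫_{N(D*)} = I - D D⁺`. -/
def projCoker (D : E →L[ℂ] E) : E →L[ℂ] E := 1 - D * pinv D

/-- `D = P₊(0) - (I - P₋(0))`. -/
def matchingOp (Pp Pm : ℝ → E →L[ℂ] E) : E →L[ℂ] E := Pp 0 - (1 - Pm 0)

/-- `H(t) = 𝒫_{N(D*)} P₋(0) U(0,t)`. -/
def solvabilityKernel (U : ℝ → ℝ → E →L[ℂ] E) (Pp Pm : ℝ → E →L[ℂ] E) (t : ℝ) : E →L[ℂ] E :=
  projCoker (matchingOp Pp Pm) * Pm 0 * U 0 t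

/-- `∫_s^∞ U(s,τ)(I - P₊(τ)) f(τ) dτ + ∫_{-∞}^s U(s,τ) P₋(τ) f(τ) dτ`. -/
def matchingVector (U : ℝ → ℝ → E →L[ℂ] E) (Pp Pm : ℝ → E →L[ℂ] E) (f : ℝ → E) (s : ℝ) : E :=
  (∫ τ in Ioi s, U s τ ((1 - Pp τ) (f τ))) + ∫ τ in Iic s, U s τ (Pm τ (f τ))

/-- The branch `t ≥ s` of the generalized Green operator. -/
def greenForward (U : ℝ → ℝ → E →L[ℂ] E) (Pp Pm : ℝ → E →L[ℂ] E) (f : ℝ → E) (t s : ℝ) : E :=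
  (∫ τ in s..t, U t τ (Pp τ (f τ))) - (∫ τ in Ioi t, U t τ ((1 - Pp τ) (f τ)))
    + U t s (Pp s (pinv (matchingOp Pp Pm) (matchingVector U Pp Pm f s)))

/-- The branch `t ≤ s` of the generalized Green operator. -/
def greenBackward (U : ℝ → ℝ → E →L[ℂ] E) (Pp Pm : ℝ → E →L[ℂ] E) (f : ℝ → E) (t s : ℝ) : E :=
  (∫ τ in Iic t, U t τ (Pm τ (f τ))) - (∫ τ in t..s, U t τ ((1 - Pm τ) (f τ)))
    + U t s ((1 - Pm s) (pinv (matchingOp Pp Pm) (matchingVector U Pp Pm f s)))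

/-- The generalized Green operator `(G[f])(t,s)`. -/
def green (U : ℝ → ℝ → E →L[ℂ] E) (Pp Pm : ℝ → E →L[ℂ] E) (f : ℝ → E) (t s : ℝ) : E :=
  if s ≤ t then greenForward U Pp Pm f t s else greenBackward U Pp Pm f t s

end SchrodingerDichotomy

end

set_option linter.unusedSectionVars false

/-! Passing to `y t = W (-t) (x t)` removes the unbounded operator: a bounded weak solution becomes
a strong solution of a linear ODE with bounded, strongly continuous coefficients. By uniqueness it
is mild, `x t = U t 0 (a + ∫₀ᵗ U 0 τ (f τ))` with `a = x 0` (`eq_mild_of_isBoundedWeakSolution`).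
Conversely every mild function is a weak solution (`isWeakSolutionOn_of_eventuallyEq`). What remains
is to find the `a` that give bounded functions.

The dichotomies, transported to time `0`, answer this on each half-line
(`HalfLineDichotomy.eq_of_bounded`, `HalfLineDichotomy.norm_mild_le`): boundedness on `[0, ∞)` means
`(I - P₊)a = -∫₀^∞ (I - P₊)U(0,τ)f`, and boundedness on `(-∞, 0]` means `P₋a = ∫_{-∞}^0 P₋U(0,τ)f`.
Subtracting the first from the second gives `Da = g`, so the cokernel projection must annihilate
`g`. As `P₋ - (I - P₊) = D`, that projection does not distinguish `P₋` from `I - P₊`, whence its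
value at `g` is `∫ H f` (`integral_solvabilityKernel`).

Both branches of the Green operator are mild, and their initial values differ by `DD⁺g - g = -∫ H f`
(`branch_initial_sub`); this is the jump. If it vanishes, the common initial value meets both
conditions. Any other admissible `a` differs from it by an element of `R(P₊) ∩ N(P₋) = P₊N(D)`,
which is the free parameter. -/

namespace SchrodingerDichotomy

/-! ### Strongly continuous operator families -/

section StronglyContinuous

variable {E F : Type*} [NormedAddCommGroup E] [NormedSpace ℂ E]
  [NormedAddCommGroup F] [NormedSpace ℂ F]

theorem exists_norm_le_of_strongly_continuous [CompleteSpace E] {B : ℝ → E →L[ℂ] F}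
    (hB : ∀ v, Continuous fun t => B t v) (R : ℝ) :
    ∃ C, 0 ≤ C ∧ ∀ t ∈ Icc (-R) R, ‖B t‖ ≤ C := by
  obtain ⟨C, hC⟩ := banach_steinhaus (g := fun t : Icc (-R) R => B t) (fun v => by
    obtain ⟨C, hC⟩ := isCompact_Icc.exists_bound_of_continuousOn (s := Icc (-R) R)
      (hB v).continuousOn
    exact ⟨C, fun t => hC t t.2⟩)
  exact ⟨max C 0, le_max_right _ _, fun t ht => (hC ⟨t, ht⟩).trans (le_max_left _ _)⟩

theorem exists_eventually_norm_le [CompleteSpace E] {B : ℝ → E →L[ℂ] F}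
    (hB : ∀ v, Continuous fun t => B t v) (t : ℝ) :
    ∃ C, 0 ≤ C ∧ ∀ᶠ τ in 𝓝 t, ‖B τ‖ ≤ C := by
  obtain ⟨C, hC0, hC⟩ := exists_norm_le_of_strongly_continuous hB (|t| + 1)
  refine ⟨C, hC0, ?_⟩
  filter_upwards [Ioo_mem_nhds (show -(|t| + 1) < t by linarith [neg_abs_le t])
    (show t < |t| + 1 by linarith [le_abs_self t])] with τ hτ
  exact hC τ (Ioo_subset_Icc_self hτ)

/-- A locally bounded operator family acts jointly continuously where it is strongly continuous. -/
theorem tendsto_apply_of_eventually_norm_le {α : Type*} {l : Filter α} {B : α → E →L[ℂ] F}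
    {g : α → E} {C : ℝ} {w : E} {z : F} (hC : ∀ᶠ τ in l, ‖B τ‖ ≤ C)
    (hB : Tendsto (fun τ => B τ w) l (𝓝 z)) (hg : Tendsto g l (𝓝 w)) :
    Tendsto (fun τ => B τ (g τ)) l (𝓝 z) := by
  have h1 : Tendsto (fun τ => B τ (g τ - w)) l (𝓝 0) := by
    refine squeeze_zero_norm' (a := fun τ => C * ‖g τ - w‖) ?_ ?_
    · filter_upwards [hC] with τ hτ
      exact (B τ).le_of_opNorm_le hτ _
    · simpa using ((hg.sub_const w).norm).const_mul C
  simpa using h1.add hB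

theorem continuous_apply_of_strongly_continuous [CompleteSpace E] {B : ℝ → E →L[ℂ] F}
    (hB : ∀ v, Continuous fun t => B t v) {g : ℝ → E} (hg : Continuous g) :
    Continuous fun t => B t (g t) := by
  refine continuous_iff_continuousAt.2 fun t => ?_
  obtain ⟨C, -, hC⟩ := exists_eventually_norm_le hB t
  exact tendsto_apply_of_eventually_norm_le hC (hB (g t)).continuousAt hg.continuousAt

/-- A product rule without norm differentiability of `B`: the increment splits as `(B τ - B t)(w t)
+ B τ (w τ - w t)`, and the local norm bound lets the second slope converge. -/
theorem hasDerivAt_apply {B : ℝ → E →L[ℂ] F} {w : ℝ → E} {w' : E} {d : F} {t C : ℝ}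
    (hC : ∀ᶠ τ in 𝓝 t, ‖B τ‖ ≤ C) (hB : ContinuousAt (fun τ => B τ w') t)
    (hd : HasDerivAt (fun τ => B τ (w t)) d t) (hw : HasDerivAt w w' t) :
    HasDerivAt (fun τ => B τ (w τ)) (d + B t w') t := by
  rw [hasDerivAt_iff_tendsto_slope] at *
  have h1 : Tendsto (fun τ => B τ (slope w t τ)) (𝓝[≠] t) (𝓝 (B t w')) :=
    tendsto_apply_of_eventually_norm_le (hC.filter_mono nhdsWithin_le_nhds)
      (hB.tendsto.mono_left nhdsWithin_le_nhds) hw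
  refine (hd.add h1).congr fun τ => ?_
  simp only [slope_def_module, ContinuousLinearMap.map_smul_of_tower, map_sub, ← smul_add]
  congr 1
  abel

end StronglyContinuous

/-! ### Existence of the Moore–Penrose inverse -/

section MoorePenrose

variable {E : Type*} [NormedAddCommGroup E] [InnerProductSpace ℂ E] [CompleteSpace E]

/-- `DX` is idempotent with the range of `D`, so this range is `ker (1 - DX)` and hence closed.
Compressing `X` by the orthogonal projections `Q` onto `R(D)` and `R` onto `N(D)ᗮ` gives `RXQ`, for
which `D(RXQ) = Q` and `(RXQ)D = R`. -/
theorem IsGeneralizedInvertible.exists_isMoorePenroseInverse {D : E →L[ℂ] E}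
    (hD : IsGeneralizedInvertible D) : ∃ X, IsMoorePenroseInverse D X := by
  obtain ⟨X, hX⟩ := hD
  have hX' : ∀ v, D (X (D v)) = D v := fun v => congrArg (fun T : E →L[ℂ] E => T v) hX
  let K : Submodule ℂ E := (1 - D * X).ker
  let N : Submodule ℂ E := D.ker
  have : CompleteSpace K := (1 - D * X).isClosed_ker.completeSpace_coe
  have : CompleteSpace N := D.isClosed_ker.completeSpace_coe
  have memK : ∀ v, v ∈ K ↔ D (X v) = v := fun v => by
    simp [K, sub_eq_zero, eq_comm (a := v)]
  let Q := K.starProjection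
  let R := Nᗮ.starProjection
  have hQmem : ∀ v, D (X (Q v)) = Q v := fun v => (memK _).1 (K.starProjection_apply_mem v)
  have hQ : ∀ v, Q (D v) = D v := fun v =>
    Submodule.starProjection_eq_self_iff.2 ((memK _).2 (hX' v))
  have hR : ∀ v, v - R v ∈ N := fun v => by
    have := Submodule.sub_starProjection_mem_orthogonal (K := Nᗮ) v
    rwa [Submodule.orthogonal_orthogonal] at this
  have hDR : ∀ v, D (R v) = D v := fun v => by
    have : D (v - R v) = 0 := hR v
    rw [map_sub, sub_eq_zero] at this
    exact this.symm
  have hRN : ∀ v ∈ N, R v = 0 := fun v hv =>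
    Submodule.starProjection_orthogonal_apply_eq_zero hv
  have hRX : ∀ v, R (X (D v)) = R v := fun v => by
    have : R (X (D v) - v) = 0 := hRN _ (show D (X (D v) - v) = 0 by simp [hX'])
    rwa [map_sub, sub_eq_zero] at this
  have hRR : ∀ v, R (R v) = R v := fun v =>
    Submodule.starProjection_eq_self_iff.2 (Submodule.starProjection_apply_mem _ v)
  have e1 : D * (R * X * Q) = Q := by
    ext v
    simp [hDR, hQmem]
  have e2 : R * X * Q * D = R := by
    ext v
    simp [hQ, hRX]
  refine ⟨R * X * Q, ?_, ?_, ?_, ?_⟩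
  · rw [e1]
    ext v
    simp [hQ]
  · rw [e2]
    ext v
    simp [hRR]
  · rw [e1]
    exact isSelfAdjoint_starProjection K
  · rw [e2]
    exact isSelfAdjoint_starProjection Nᗮ

theorem IsGeneralizedInvertible.isMoorePenroseInverse_pinv {D : E →L[ℂ] E}
    (hD : IsGeneralizedInvertible D) : IsMoorePenroseInverse D (pinv D) := by
  have h := hD.exists_isMoorePenroseInverse
  rw [pinv, dif_pos h]
  exact h.choose_spec

theorem IsGeneralizedInvertible.apply_pinv_apply {D : E →L[ℂ] E}
    (hD : IsGeneralizedInvertible D) (v : E) : D (pinv D (D v)) = D v :=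
  congrArg (fun T : E →L[ℂ] E => T v) hD.isMoorePenroseInverse_pinv.mul_mul

theorem projCoker_apply (D : E →L[ℂ] E) (v : E) : projCoker D v = v - D (pinv D v) := rfl

theorem projKer_apply (D : E →L[ℂ] E) (v : E) : projKer D v = v - pinv D (D v) := rfl

theorem IsGeneralizedInvertible.apply_projKer {D : E →L[ℂ] E}
    (hD : IsGeneralizedInvertible D) (v : E) : D (projKer D v) = 0 := by
  rw [projKer_apply, map_sub, hD.apply_pinv_apply, sub_self]

theorem IsGeneralizedInvertible.projCoker_apply_apply {D : E →L[ℂ] E}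
    (hD : IsGeneralizedInvertible D) (v : E) : projCoker D (D v) = 0 := by
  rw [projCoker_apply, hD.apply_pinv_apply, sub_self]

end MoorePenrose

/-! ### Bounded mild solutions on a half-line -/

section HalfLine

variable {E : Type*} [NormedAddCommGroup E] [NormedSpace ℂ E] [CompleteSpace E]

theorem integral_Ioi_exp_neg_mul_sub {α : ℝ} (hα : 0 < α) (t : ℝ) :
    ∫ τ in Ioi t, Real.exp (-α * (τ - t)) = α⁻¹ := by
  have : ∀ τ, Real.exp (-α * (τ - t)) = Real.exp (α * t) * Real.exp (-α * τ) := fun τ => by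
    rw [← Real.exp_add]
    ring_nf
  simp only [this]
  rw [integral_const_mul, integral_exp_mul_Ioi (neg_lt_zero.2 hα), neg_div_neg_eq, mul_div_assoc',
    ← Real.exp_add, neg_mul, add_neg_cancel, Real.exp_zero, one_div]

theorem integral_exp_neg_mul_sub_le {α : ℝ} (hα : 0 < α) (t : ℝ) :
    ∫ τ in (0 : ℝ)..t, Real.exp (-α * (t - τ)) ≤ α⁻¹ := by
  have hd : ∀ τ, HasDerivAt (fun τ => α⁻¹ * Real.exp (-α * (t - τ))) (Real.exp (-α * (t - τ))) τ :=
    fun τ => by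
      refine (((((hasDerivAt_id τ).const_sub t).const_mul (-α)).exp).const_mul α⁻¹).congr_deriv ?_
      simp only [id]
      field_simp
  rw [intervalIntegral.integral_eq_sub_of_hasDerivAt (fun τ _ => hd τ)
    (Continuous.intervalIntegrable (by fun_prop) _ _)]
  simp only [sub_self, mul_zero, Real.exp_zero, mul_one, tsub_le_iff_right, le_add_iff_nonneg_right]
  positivity

theorem integrableOn_Ioi_exp_neg_mul_sub {α : ℝ} (hα : 0 < α) (t : ℝ) :
    IntegrableOn (fun τ => Real.exp (-α * (τ - t))) (Ioi t) := by
  have : (fun τ => Real.exp (-α * (τ - t))) = fun τ => Real.exp (α * t) * Real.exp (-α * τ) := by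
    funext τ
    rw [← Real.exp_add]
    ring_nf
  rw [this]
  exact (exp_neg_integrableOn_Ioi t hα).const_mul _

/-- Dichotomy estimates on `[0, ∞)` for the propagator `K` with inverse `L`, transported to time
`0`: `P` is the stable projection at time `0`. -/
structure HalfLineDichotomy (K L : ℝ → E →L[ℂ] E) (P : E →L[ℂ] E) (M α : ℝ) : Prop where
  idem : ∀ v, P (P v) = P v
  left_inv : ∀ t v, L t (K t v) = v
  right_inv : ∀ t v, K t (L t v) = v
  zero_left : K 0 = 1
  zero_right : L 0 = 1
  pos : 0 < α
  stable : ∀ s t, 0 ≤ s → s ≤ t → ∀ v, ‖K t (P (L s v))‖ ≤ M * Real.exp (-α * (t - s)) * ‖v‖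
  unstable : ∀ s t, 0 ≤ s → s ≤ t → ∀ v,
    ‖K s (L t v - P (L t v))‖ ≤ M * Real.exp (-α * (t - s)) * ‖v‖

namespace HalfLineDichotomy

variable {K L : ℝ → E →L[ℂ] E} {P : E →L[ℂ] E} {M α : ℝ} {f : ℝ → E} {B : ℝ}

theorem integrableOn_unstable (h : HalfLineDichotomy K L P M α) (hM : 0 ≤ M)
    (hL : Continuous fun t => L t (f t)) (hf : ∀ t, ‖f t‖ ≤ B) {t : ℝ} (ht : 0 ≤ t) :
    IntegrableOn (fun τ => K t (L τ (f τ) - P (L τ (f τ)))) (Ioi t) := by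
  refine Integrable.mono' (((integrableOn_Ioi_exp_neg_mul_sub h.pos t).const_mul M).mul_const B)
    ((K t).continuous.comp (hL.sub (P.continuous.comp hL))).aestronglyMeasurable ?_
  refine (ae_restrict_mem measurableSet_Ioi).mono fun τ hτ => ?_
  refine (h.unstable t τ ht (le_of_lt hτ) _).trans ?_
  gcongr
  exact hf τ

theorem integrableOn_unstable_zero (h : HalfLineDichotomy K L P M α) (hM : 0 ≤ M)
    (hL : Continuous fun t => L t (f t)) (hf : ∀ t, ‖f t‖ ≤ B) :
    IntegrableOn (fun τ => L τ (f τ) - P (L τ (f τ))) (Ioi 0) := by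
  simpa [h.zero_left] using h.integrableOn_unstable hM hL hf le_rfl

/-- Pulled back from time `t` to time `0`, the unstable part of a bounded solution has size
`O(e^{-αt})`. That part is also `(I - P)a` plus the unstable integral up to `t`, so the limit `t →
∞` determines `(I - P)a`. -/
theorem eq_of_bounded (h : HalfLineDichotomy K L P M α) (hM : 0 ≤ M)
    (hL : Continuous fun t => L t (f t)) (hf : ∀ t, ‖f t‖ ≤ B) {a : E} {C : ℝ}
    (hC : ∀ t, 0 ≤ t → ‖K t (a + ∫ τ in (0 : ℝ)..t, L τ (f τ))‖ ≤ C) :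
    a - P a = -∫ τ in Ioi 0, (L τ (f τ) - P (L τ (f τ))) := by
  let Q : E →L[ℂ] E := 1 - P
  have hQ : ∀ v, Q v = v - P v := fun _ => rfl
  have h1 : Tendsto (fun t : ℝ => Q (a + ∫ τ in (0 : ℝ)..t, L τ (f τ))) atTop (𝓝 0) := by
    refine squeeze_zero_norm' (a := fun t => M * Real.exp (-α * t) * C) ?_ ?_
    · filter_upwards [eventually_ge_atTop 0] with t ht
      have := h.unstable 0 t le_rfl ht (K t (a + ∫ τ in (0 : ℝ)..t, L τ (f τ)))
      rw [h.left_inv, h.zero_left, sub_zero] at this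
      refine this.trans ?_
      gcongr
      exact hC t ht
    · have : Tendsto (fun t : ℝ => Real.exp (-α * t)) atTop (𝓝 0) :=
        Real.tendsto_exp_atBot.comp (tendsto_id.const_mul_atTop_of_neg (neg_lt_zero.2 h.pos))
      simpa using (this.const_mul M).mul_const C
  have h2 : Tendsto (fun t : ℝ => Q a + ∫ τ in (0 : ℝ)..t, (L τ (f τ) - P (L τ (f τ)))) atTop
      (𝓝 (Q a + ∫ τ in Ioi 0, (L τ (f τ) - P (L τ (f τ))))) :=
    (intervalIntegral_tendsto_integral_Ioi 0 (h.integrableOn_unstable_zero hM hL hf)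
      tendsto_id).const_add _
  have h3 : ∀ t : ℝ, Q (a + ∫ τ in (0 : ℝ)..t, L τ (f τ)) =
      Q a + ∫ τ in (0 : ℝ)..t, (L τ (f τ) - P (L τ (f τ))) := fun t => by
    rw [map_add, ← Q.intervalIntegral_comp_comm (hL.intervalIntegrable _ _)]
    rfl
  simp only [h3] at h1
  exact eq_neg_of_add_eq_zero_left (tendsto_nhds_unique h2 h1)

/-- The mild solution in terms of absolutely convergent stable and unstable parts. -/
theorem mild_eq (h : HalfLineDichotomy K L P M α) (hM : 0 ≤ M)
    (hL : Continuous fun t => L t (f t)) (hf : ∀ t, ‖f t‖ ≤ B) {b : E} {t : ℝ} (ht : 0 ≤ t) :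
    K t ((b - ∫ τ in Ioi 0, (L τ (f τ) - P (L τ (f τ)))) + ∫ τ in (0 : ℝ)..t, L τ (f τ)) =
      (∫ τ in (0 : ℝ)..t, K t (P (L τ (f τ))))
        - (∫ τ in Ioi t, K t (L τ (f τ) - P (L τ (f τ)))) + K t b := by
  have hi := h.integrableOn_unstable_zero hM hL hf
  have hPL : Continuous fun t => P (L t (f t)) := P.continuous.comp hL
  have hit : IntegrableOn (fun τ => L τ (f τ) - P (L τ (f τ))) (Ioi t) :=
    hi.mono_set (Ioi_subset_Ioi ht)
  have e1 : ∫ τ in (0 : ℝ)..t, K t (P (L τ (f τ))) = K t (∫ τ in (0 : ℝ)..t, P (L τ (f τ))) :=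
    (K t).intervalIntegral_comp_comm (hPL.intervalIntegrable _ _)
  have e2 : ∫ τ in Ioi t, K t (L τ (f τ) - P (L τ (f τ))) =
      K t (∫ τ in Ioi t, (L τ (f τ) - P (L τ (f τ)))) := (K t).integral_comp_comm hit
  have e3 : ∫ τ in (0 : ℝ)..t, L τ (f τ) = (∫ τ in (0 : ℝ)..t, P (L τ (f τ))) +
      ∫ τ in (0 : ℝ)..t, (L τ (f τ) - P (L τ (f τ))) := by
    rw [intervalIntegral.integral_sub (hL.intervalIntegrable _ _) (hPL.intervalIntegrable _ _),
      add_sub_cancel]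
  have e4 := intervalIntegral.integral_interval_add_Ioi hi hit
  rw [e1, e2, e3, ← e4, ← map_sub, ← map_add]
  congr 1
  abel

/-- The condition on `a` cancels the growing component. What is left is a stable convolution and an
unstable tail, each at most `M B / α`, and the decaying term `K t (P a)`. -/
theorem norm_mild_le (h : HalfLineDichotomy K L P M α) (hM : 0 ≤ M)
    (hL : Continuous fun t => L t (f t)) (hf : ∀ t, ‖f t‖ ≤ B) {a : E}
    (ha : a - P a = -∫ τ in Ioi 0, (L τ (f τ) - P (L τ (f τ)))) {t : ℝ} (ht : 0 ≤ t) :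
    ‖K t (a + ∫ τ in (0 : ℝ)..t, L τ (f τ))‖ ≤ M * α⁻¹ * B + M * α⁻¹ * B + M * ‖a‖ := by
  have hB : 0 ≤ B := (norm_nonneg _).trans (hf 0)
  have ha' : a = P a - ∫ τ in Ioi 0, (L τ (f τ) - P (L τ (f τ))) := by
    rw [sub_eq_add_neg, ← ha, add_sub_cancel]
  have e : K t (a + ∫ τ in (0 : ℝ)..t, L τ (f τ)) = _ :=
    (congrArg (fun a => K t (a + ∫ τ in (0 : ℝ)..t, L τ (f τ))) ha').trans
      (h.mild_eq hM hL hf ht)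
  rw [e]
  refine norm_add_le_of_le (norm_sub_le_of_le ?_ ?_) ?_
  · refine (intervalIntegral.norm_integral_le_of_norm_le ht
      (g := fun τ => M * Real.exp (-α * (t - τ)) * B)
      (Eventually.of_forall fun τ hτ => (h.stable τ t hτ.1.le hτ.2 _).trans ?_)
      (Continuous.intervalIntegrable (by fun_prop) _ _)).trans ?_
    · gcongr
      exact hf τ
    · rw [intervalIntegral.integral_mul_const, intervalIntegral.integral_const_mul]
      gcongr
      exact integral_exp_neg_mul_sub_le h.pos t
  · refine (norm_integral_le_of_norm_le
      (((integrableOn_Ioi_exp_neg_mul_sub h.pos t).const_mul M).mul_const B)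
      ((ae_restrict_mem measurableSet_Ioi).mono fun τ hτ =>
        (h.unstable t τ ht (le_of_lt hτ) _).trans ?_)).trans (le_of_eq ?_)
    · gcongr
      exact hf τ
    · rw [integral_mul_const, integral_const_mul, integral_Ioi_exp_neg_mul_sub h.pos]
  · have := h.stable 0 t le_rfl ht a
    rw [h.zero_right] at this
    refine this.trans ?_
    gcongr
    refine mul_le_of_le_one_right hM (Real.exp_le_one_iff.2 ?_)
    nlinarith [h.pos]

end HalfLineDichotomy

end HalfLine

/-! ### Uniqueness for linear equations with strongly continuous coefficients -/

section LinearODE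

variable {E : Type*} [NormedAddCommGroup E] [NormedSpace ℂ E] [CompleteSpace E]

theorem linearODE_solution_unique {N : ℝ → E →L[ℂ] E} (hN : ∀ v, Continuous fun t => N t v)
    {g y z : ℝ → E} (hy : ∀ t, HasDerivAt y (N t (y t) + g t) t)
    (hz : ∀ t, HasDerivAt z (N t (z t) + g t) t) {t₀ : ℝ} (h₀ : y t₀ = z t₀) : y = z := by
  funext t
  -- The extra `1` puts both times in the open interval; local boundedness of `N` there gives one
  -- Lipschitz constant.
  set R := max |t| |t₀| + 1
  obtain ⟨C, hC0, hC⟩ := exists_norm_le_of_strongly_continuous hN R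
  have mem : ∀ r, |r| < R → r ∈ Ioo (-R) R := fun r hr => abs_lt.1 hr
  refine ODE_solution_unique_of_mem_Ioo (v := fun t x => N t x + g t) (s := fun _ => univ)
    (K := ⟨C, hC0⟩) (a := -R) (b := R) (t₀ := t₀) ?_ ?_ (fun t _ => ⟨hy t, trivial⟩)
    (fun t _ => ⟨hz t, trivial⟩) h₀ ?_
  · intro r hr
    refine LipschitzOnWith.of_dist_le_mul fun a _ b _ => ?_
    rw [dist_add_right, dist_eq_norm, dist_eq_norm, ← map_sub]
    exact (N r).le_of_opNorm_le (hC r (Ioo_subset_Icc_self hr)) _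
  · exact mem _ ((le_max_right _ _).trans_lt (lt_add_one _))
  · exact mem _ ((le_max_left _ _).trans_lt (lt_add_one _))

end LinearODE

variable {E : Type*} [NormedAddCommGroup E] [InnerProductSpace ℂ E] [CompleteSpace E]

/-! ### The unitary group of the free operator -/

namespace IsUnitaryGroupOf

variable {A : E →ₗ.[ℂ] E} {W : ℝ → E →L[ℂ] E}

theorem map_add_apply (hW : IsUnitaryGroupOf A W) (s t : ℝ) (v : E) :
    W (s + t) v = W s (W t v) := by
  rw [hW.map_add]; rfl

theorem apply_neg_apply (hW : IsUnitaryGroupOf A W) (t : ℝ) (v : E) : W t (W (-t) v) = v := by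
  rw [← hW.map_add_apply, add_neg_cancel, hW.map_zero]; rfl

theorem neg_apply_apply (hW : IsUnitaryGroupOf A W) (t : ℝ) (v : E) : W (-t) (W t v) = v := by
  rw [← hW.map_add_apply, neg_add_cancel, hW.map_zero]; rfl

theorem norm_apply (hW : IsUnitaryGroupOf A W) (t : ℝ) (v : E) : ‖W t v‖ = ‖v‖ :=
  ContinuousLinearMap.norm_map_of_mem_unitary (hW.unitary t) v

theorem inner_apply_left (hW : IsUnitaryGroupOf A W) (t : ℝ) (u v : E) :
    inner ℂ (W t u) v = inner ℂ u (W (-t) v) := by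
  conv_lhs => rw [← hW.apply_neg_apply t v]
  exact ContinuousLinearMap.inner_map_map_of_mem_unitary (hW.unitary t) _ _

theorem hasDerivAt_apply_comp (hW : IsUnitaryGroupOf A W) (t : ℝ) (η : A.domain) :
    HasDerivAt (fun τ => W t (W τ (η : E))) (-Complex.I • W t (A η)) 0 := by
  have h0 : HasDerivAt (fun τ => W τ (η : E)) (-Complex.I • A η) 0 :=
    (hW.generator _ _).2 ⟨η.2, rfl⟩
  have := ((W t).restrictScalars ℝ).hasFDerivAt.comp_hasDerivAt 0 h0
  simpa only [ContinuousLinearMap.coe_restrictScalars', map_smul, Function.comp_def] using this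

theorem hasDerivAt (hW : IsUnitaryGroupOf A W) (t : ℝ) (η : A.domain) :
    HasDerivAt (fun τ => W τ (η : E)) (-Complex.I • W t (A η)) t := by
  have h := hW.hasDerivAt_apply_comp t η
  rw [← sub_self t] at h
  have h := h.comp_sub_const t t
  refine h.congr_of_eventuallyEq (Eventually.of_forall fun τ => ?_)
  simp only [← hW.map_add_apply, add_sub_cancel]

/-- The domain is exactly the set of vectors whose orbit is differentiable at `0`, and `W τ (W t η)
= W t (W τ η)` inherits this from `η`. -/
theorem apply_mem_domain (hW : IsUnitaryGroupOf A W) (t : ℝ) (η : A.domain) :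
    ∃ h : W t (η : E) ∈ A.domain, A ⟨W t η, h⟩ = W t (A η) := by
  have h : HasDerivAt (fun τ => W τ (W t (η : E))) (-Complex.I • W t (A η)) 0 := by
    refine (hW.hasDerivAt_apply_comp t η).congr_of_eventuallyEq (Eventually.of_forall fun τ => ?_)
    simp only [← hW.map_add_apply, add_comm]
  obtain ⟨hm, he⟩ := (hW.generator _ _).1 h
  exact ⟨hm, (smul_right_injective E (neg_ne_zero.2 Complex.I_ne_zero) he).symm⟩

theorem continuous_neg (hW : IsUnitaryGroupOf A W) (v : E) : Continuous fun t => W (-t) v :=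
  (hW.continuous v).comp continuous_id.neg

theorem continuous_interaction (hW : IsUnitaryGroupOf A W) {V : ℝ → E →L[ℂ] E}
    (hV : ∀ v, Continuous fun t => V t v) (v : E) :
    Continuous fun t => interaction W V t v :=
  continuous_apply_of_strongly_continuous hW.continuous_neg
    (continuous_apply_of_strongly_continuous hV (hW.continuous v))

end IsUnitaryGroupOf

/-! ### Convergence and differentiability of the Dyson series -/

section Dyson

variable {W V : ℝ → E →L[ℂ] E}

theorem hasDerivAt_dysonTerm_succ (hI : ∀ v, Continuous fun t => interaction W V t v)
    {s : ℝ} {ψ : E} {n : ℕ} (hn : Continuous (dysonTerm W V s ψ n)) (t : ℝ) :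
    HasDerivAt (dysonTerm W V s ψ (n + 1))
      (-Complex.I • interaction W V t (dysonTerm W V s ψ n t)) t :=
  ((continuous_apply_of_strongly_continuous hI hn).integral_hasStrictDerivAt s
    t).hasDerivAt.const_smul (-Complex.I)

theorem continuous_dysonTerm (hI : ∀ v, Continuous fun t => interaction W V t v) (s : ℝ) (ψ : E)
    (n : ℕ) : Continuous (dysonTerm W V s ψ n) := by
  induction n with
  | zero => exact continuous_const
  | succ n ih =>
    exact continuous_iff_continuousAt.2 fun t => (hasDerivAt_dysonTerm_succ hI ih t).continuousAt

/-- The `n!` is the volume factor of the ordered simplex, obtained by integrating `|τ - s| ^ n` at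
each induction step; absolute values cover `t < s`. -/
theorem norm_dysonTerm_le {R C : ℝ} (hC0 : 0 ≤ C)
    (hC : ∀ t ∈ Icc (-R) R, ‖interaction W V t‖ ≤ C) {s : ℝ} (hs : s ∈ Icc (-R) R) (ψ : E)
    (n : ℕ) : ∀ t ∈ Icc (-R) R,
      ‖dysonTerm W V s ψ n t‖ ≤ (C * |t - s|) ^ n / n.factorial * ‖ψ‖ := by
  induction n with
  | zero => intro t _; simp [dysonTerm]
  | succ n ih =>
    intro t ht
    have hsub : uIoc s t ⊆ Icc (-R) R :=
      uIoc_subset_uIcc.trans (uIcc_subset_Icc hs ht)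
    have h1 : ‖∫ τ in s..t, interaction W V τ (dysonTerm W V s ψ n τ)‖ ≤
        |∫ τ in s..t, C * (C ^ n / n.factorial * ‖ψ‖) * |τ - s| ^ n| := by
      refine intervalIntegral.norm_integral_le_abs_of_norm_le ?_ ?_
      · refine (ae_restrict_mem measurableSet_uIoc).mono fun τ hτ => ?_
        refine ((interaction W V τ).le_of_opNorm_le_of_le (hC τ (hsub hτ))
          (ih τ (hsub hτ))).trans (le_of_eq ?_)
        rw [mul_pow]
        ring
      · exact (by fun_prop : Continuous fun τ : ℝ =>
          C * (C ^ n / n.factorial * ‖ψ‖) * |τ - s| ^ n).intervalIntegrable _ _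
    rw [dysonTerm, norm_smul, norm_neg, Complex.norm_I, one_mul]
    refine h1.trans (le_of_eq ?_)
    rw [intervalIntegral.integral_const_mul, abs_mul, intervalIntegral.abs_intervalIntegral_eq,
      integral_pow_abs_sub_uIoc, abs_of_nonneg (by positivity), abs_of_nonneg (by positivity),
      mul_pow, Nat.factorial_succ]
    push_cast
    field_simp
    ring

theorem norm_dysonTerm_le' {R C : ℝ} (hC0 : 0 ≤ C)
    (hC : ∀ t ∈ Icc (-R) R, ‖interaction W V t‖ ≤ C) {s t : ℝ} (hs : s ∈ Icc (-R) R) (ψ : E)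
    (n : ℕ) (ht : t ∈ Icc (-R) R) :
      ‖dysonTerm W V s ψ n t‖ ≤ (C * (2 * R)) ^ n / n.factorial * ‖ψ‖ := by
  refine (norm_dysonTerm_le hC0 hC hs ψ n t ht).trans ?_
  have : |t - s| ≤ 2 * R := abs_le.2 ⟨by linarith [hs.2, ht.1], by linarith [hs.1, ht.2]⟩
  gcongr

theorem summable_dysonTerm (hI : ∀ v, Continuous fun t => interaction W V t v) (s : ℝ) (ψ : E)
    (t : ℝ) : Summable fun n => dysonTerm W V s ψ n t := by
  obtain ⟨C, hC0, hC⟩ := exists_norm_le_of_strongly_continuous hI (max |s| |t|)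
  exact .of_norm_bounded ((Real.summable_pow_div_factorial _).mul_right ‖ψ‖) fun n =>
    norm_dysonTerm_le' hC0 hC (abs_le.1 (le_max_left _ _)) ψ n (abs_le.1 (le_max_right _ _))

theorem norm_tsum_dysonTerm_le {R C : ℝ} (hC0 : 0 ≤ C)
    (hC : ∀ t ∈ Icc (-R) R, ‖interaction W V t‖ ≤ C) {s t : ℝ} (hs : s ∈ Icc (-R) R) (ψ : E)
    (ht : t ∈ Icc (-R) R) :
    ‖∑' n, dysonTerm W V s ψ n t‖ ≤ (∑' n : ℕ, (C * (2 * R)) ^ n / n.factorial) * ‖ψ‖ :=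
  tsum_of_norm_bounded ((Real.summable_pow_div_factorial _).hasSum.mul_right ‖ψ‖)
    fun n => norm_dysonTerm_le' hC0 hC hs ψ n ht

theorem tsum_dysonTerm_self (s : ℝ) (ψ : E) : ∑' n, dysonTerm W V s ψ n s = ψ := by
  rw [tsum_eq_single 0]
  · rfl
  · rintro (_ | n) hn
    · exact absurd rfl hn
    · simp [dysonTerm]

theorem hasDerivAt_tsum_dysonTerm (hI : ∀ v, Continuous fun t => interaction W V t v) (s : ℝ)
    (ψ : E) (t : ℝ) :
    HasDerivAt (fun t => ∑' n, dysonTerm W V s ψ n t)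
      (-Complex.I • interaction W V t (∑' n, dysonTerm W V s ψ n t)) t := by
  set R := max |s| |t| + 1
  have hs : s ∈ Ioo (-R) R := abs_lt.1 ((le_max_left _ _).trans_lt (lt_add_one _))
  have ht : t ∈ Ioo (-R) R := abs_lt.1 ((le_max_right _ _).trans_lt (lt_add_one _))
  obtain ⟨C, hC0, hC⟩ := exists_norm_le_of_strongly_continuous hI R
  -- Only the tail is differentiated termwise: the zeroth term is constant, and the derivative of
  -- term `n + 1` is the generator applied to term `n`, so the differentiated tail reproduces the
  -- full series.
  have h := hasDerivAt_tsum_of_isPreconnected (t := Ioo (-R) R)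
    (g := fun n => dysonTerm W V s ψ (n + 1))
    (g' := fun n t => -Complex.I • interaction W V t (dysonTerm W V s ψ n t))
    (((Real.summable_pow_div_factorial (C * (2 * R))).mul_right ‖ψ‖).mul_left C)
    isOpen_Ioo isPreconnected_Ioo
    (fun n r _ => hasDerivAt_dysonTerm_succ hI (continuous_dysonTerm hI s ψ n) r)
    (fun n r hr => by
      have hr' := Ioo_subset_Icc_self hr
      rw [norm_smul, norm_neg, Complex.norm_I, one_mul]
      exact (interaction W V r).le_of_opNorm_le_of_le (hC r hr')
        (norm_dysonTerm_le' hC0 hC (Ioo_subset_Icc_self hs) ψ n hr'))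
    hs ((summable_nat_add_iff 1).2 (summable_dysonTerm hI s ψ s)) ht
  have hsum := (summable_dysonTerm hI s ψ t)
  rw [tsum_const_smul'', ← (interaction W V t).map_tsum hsum] at h
  refine (h.const_add ψ).congr_of_eventuallyEq (Eventually.of_forall fun r => ?_)
  exact (summable_dysonTerm hI s ψ r).tsum_eq_zero_add

end Dyson

/-! ### Evolution families and mild solutions -/

/-- The data of an evolution family together with the unitary group that generates it. -/
structure IsEvolutionFamilyVia (A : E →ₗ.[ℂ] E) (V : ℝ → E →L[ℂ] E) (U : ℝ → ℝ → E →L[ℂ] E)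
    (W : ℝ → E →L[ℂ] E) : Prop where
  unitaryGroup : IsUnitaryGroupOf A W
  continuous_V : ∀ v, Continuous fun t => V t v
  eq_dyson : ∀ t s ψ, U t s ψ = W t (∑' n, dysonTerm W V s (W (-s) ψ) n t)

theorem smul_interaction_apply (W V : ℝ → E →L[ℂ] E) (t : ℝ) (v : E) :
    (-Complex.I • interaction W V t) v = -Complex.I • W (-t) (V t (W t v)) := rfl

namespace IsEvolutionFamilyVia

variable {A : E →ₗ.[ℂ] E} {V W : ℝ → E →L[ℂ] E} {U : ℝ → ℝ → E →L[ℂ] E}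

theorem continuous_interaction (h : IsEvolutionFamilyVia A V U W) (v : E) :
    Continuous fun t => interaction W V t v :=
  h.unitaryGroup.continuous_interaction h.continuous_V v

theorem neg_apply (h : IsEvolutionFamilyVia A V U W) (t s : ℝ) (ψ : E) :
    W (-t) (U t s ψ) = ∑' n, dysonTerm W V s (W (-s) ψ) n t := by
  rw [h.eq_dyson, h.unitaryGroup.neg_apply_apply]

theorem apply_self (h : IsEvolutionFamilyVia A V U W) (s : ℝ) (ψ : E) : U s s ψ = ψ := by
  rw [h.eq_dyson, tsum_dysonTerm_self, h.unitaryGroup.apply_neg_apply]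

theorem hasDerivAt_neg_apply (h : IsEvolutionFamilyVia A V U W) (s : ℝ) (ψ : E) (t : ℝ) :
    HasDerivAt (fun t => W (-t) (U t s ψ)) (-Complex.I • interaction W V t (W (-t) (U t s ψ))) t := by
  simp only [h.neg_apply]
  exact hasDerivAt_tsum_dysonTerm h.continuous_interaction s _ t

theorem continuous_smul_interaction (h : IsEvolutionFamilyVia A V U W) (v : E) :
    Continuous fun t => (-Complex.I • interaction W V t) v :=
  (h.continuous_interaction v).const_smul _

/-- In the interaction picture both sides solve the same linear ODE in `t` and agree at `t = r`. No
order on the times is needed, so each `U t s` is invertible with inverse `U s t`. -/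
theorem apply_apply (h : IsEvolutionFamilyVia A V U W) (t r s : ℝ) (ψ : E) :
    U t r (U r s ψ) = U t s ψ := by
  have key : (fun t => W (-t) (U t r (U r s ψ))) = fun t => W (-t) (U t s ψ) := by
    refine linearODE_solution_unique (N := fun t => -Complex.I • interaction W V t)
      (g := fun _ => 0) (t₀ := r) h.continuous_smul_interaction ?_ ?_ ?_
    · intro t
      simpa using h.hasDerivAt_neg_apply r (U r s ψ) t
    · intro t
      simpa using h.hasDerivAt_neg_apply s ψ t
    · simp only [h.apply_self]
  have := congrArg (W t) (congrFun key t)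
  simpa only [h.unitaryGroup.apply_neg_apply] using this

theorem continuous_apply_left (h : IsEvolutionFamilyVia A V U W) (s : ℝ) (ψ : E) :
    Continuous fun t => U t s ψ := by
  have h1 : Continuous fun t => W (-t) (U t s ψ) :=
    continuous_iff_continuousAt.2 fun t => (h.hasDerivAt_neg_apply s ψ t).continuousAt
  simpa only [h.unitaryGroup.apply_neg_apply] using
    continuous_apply_of_strongly_continuous h.unitaryGroup.continuous h1

theorem exists_norm_le (h : IsEvolutionFamilyVia A V U W) (R : ℝ) :
    ∃ K, ∀ t ∈ Icc (-R) R, ∀ s ∈ Icc (-R) R, ‖U t s‖ ≤ K := by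
  obtain ⟨C, hC0, hC⟩ := exists_norm_le_of_strongly_continuous h.continuous_interaction R
  refine ⟨∑' n : ℕ, (C * (2 * R)) ^ n / n.factorial, fun t ht s hs => ?_⟩
  have hR : 0 ≤ R := by linarith [ht.1, ht.2]
  refine ContinuousLinearMap.opNorm_le_bound _ (tsum_nonneg fun n => by positivity) fun ψ => ?_
  rw [h.eq_dyson, h.unitaryGroup.norm_apply, ← h.unitaryGroup.norm_apply (-s) ψ]
  exact norm_tsum_dysonTerm_le hC0 hC hs _ ht

theorem continuous_apply_right (h : IsEvolutionFamilyVia A V U W) (t : ℝ) (ψ : E) :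
    Continuous fun s => U t s ψ := by
  refine continuous_iff_continuousAt.2 fun s => ?_
  obtain ⟨K, hK⟩ := h.exists_norm_le (max |t| |s| + 1)
  have ht := abs_le.1 ((le_max_left |t| |s|).trans (lt_add_one _).le)
  have hs := abs_lt.1 ((le_max_right |t| |s|).trans_lt (lt_add_one _))
  have hK' : ∀ᶠ r in 𝓝 s, ‖U t r‖ ≤ K := by
    filter_upwards [Ioo_mem_nhds hs.1 hs.2] with r hr
    exact hK t ht r (Ioo_subset_Icc_self hr)
  -- By the cocycle law this expression is `U t r ψ - U t s ψ`, so continuity in the first variable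
  -- and local boundedness yield continuity in the second.
  have h1 : Tendsto (fun r => U t r (ψ - U r s ψ)) (𝓝 s) (𝓝 0) := by
    refine tendsto_apply_of_eventually_norm_le hK' (w := 0) (by simp) ?_
    have := ((h.continuous_apply_left s ψ).tendsto s).const_sub ψ
    rwa [h.apply_self, sub_self] at this
  have h2 := h1.add_const (U t s ψ)
  simpa only [ContinuousAt, map_sub, h.apply_apply, sub_add_cancel, zero_add] using h2

theorem continuous_apply_comp (h : IsEvolutionFamilyVia A V U W) (t : ℝ) {f : ℝ → E}
    (hf : Continuous f) : Continuous fun s => U t s (f s) :=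
  continuous_apply_of_strongly_continuous (h.continuous_apply_right t) hf

theorem hasDerivAt_primitive (h : IsEvolutionFamilyVia A V U W) {f : ℝ → E} (hf : Continuous f)
    (t : ℝ) : HasDerivAt (fun t => ∫ τ in (0 : ℝ)..t, U 0 τ (f τ)) (U 0 t (f t)) t :=
  ((h.continuous_apply_comp 0 hf).integral_hasStrictDerivAt 0 t).hasDerivAt

theorem continuous_mild (h : IsEvolutionFamilyVia A V U W) {f : ℝ → E} (hf : Continuous f)
    (a : E) : Continuous fun t => U t 0 (a + ∫ τ in (0 : ℝ)..t, U 0 τ (f τ)) :=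
  continuous_apply_of_strongly_continuous (h.continuous_apply_left 0)
    (continuous_const.add (continuous_iff_continuousAt.2
      fun t => (h.hasDerivAt_primitive hf t).continuousAt))

/-- Variation of constants in the interaction picture. -/
theorem hasDerivAt_mild (h : IsEvolutionFamilyVia A V U W) {f : ℝ → E} (hf : Continuous f)
    (a : E) (t : ℝ) :
    HasDerivAt (fun t => W (-t) (U t 0 (a + ∫ τ in (0 : ℝ)..t, U 0 τ (f τ))))
      ((-Complex.I • interaction W V t) (W (-t) (U t 0 (a + ∫ τ in (0 : ℝ)..t, U 0 τ (f τ))))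
        + W (-t) (f t)) t := by
  have hB : ∀ v, Continuous fun t => (W (-t) * U t 0) v := fun v =>
    continuous_iff_continuousAt.2 fun t => (h.hasDerivAt_neg_apply 0 v t).continuousAt
  obtain ⟨C, -, hC⟩ := exists_eventually_norm_le hB t
  have := hasDerivAt_apply hC (hB _).continuousAt (h.hasDerivAt_neg_apply 0 _ t)
    ((h.hasDerivAt_primitive hf t).const_add a)
  have hmul : ∀ (r : ℝ) (v : E), (W (-r) * U r 0) v = W (-r) (U r 0 v) := fun _ _ => rfl
  simp only [hmul, h.apply_apply, h.apply_self] at this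
  exact this

/-- Write `⟪η, x⟫ = ⟪W (-τ) η, W (-τ) x⟫`: both factors are differentiable, although `x` itself need
not be. The vector `a` may vary with the point, which accommodates functions given by different
branches. -/
theorem isWeakSolutionOn_of_eventuallyEq (h : IsEvolutionFamilyVia A V U W)
    {f : ℝ → E} (hf : Continuous f) {x : ℝ → E} {J : Set ℝ}
    (hx : ∀ t ∈ J, ∃ a, x =ᶠ[𝓝 t] fun t => U t 0 (a + ∫ τ in (0 : ℝ)..t, U 0 τ (f τ))) :
    IsWeakSolutionOn A V f x J := by
  intro η t ht
  obtain ⟨a, ha⟩ := hx t ht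
  have hxt : x t = _ := ha.eq_of_nhds
  have hW := h.unitaryGroup
  have h1 : HasDerivAt (fun τ => W (-τ) (η : E)) (Complex.I • W (-t) (A η)) t := by
    have := (hW.hasDerivAt (-t) η).scomp t (hasDerivAt_neg t)
    simpa [Function.comp_def] using this
  have h2 := h1.inner ℂ (h.hasDerivAt_mild hf a t)
  rw [← hxt] at h2
  have h3 : (fun τ => inner ℂ (η : E) (x τ)) =ᶠ[𝓝 t] fun τ => inner ℂ (W (-τ) (η : E))
      (W (-τ) (U τ 0 (a + ∫ τ in (0 : ℝ)..τ, U 0 τ (f τ)))) := by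
    filter_upwards [ha] with τ hτ
    rw [hτ, hW.inner_apply_left, neg_neg, hW.apply_neg_apply]
  refine (h2.congr_of_eventuallyEq h3).congr_deriv ?_
  have h4 : ∀ u v, inner ℂ (W (-t) u) (W (-t) v) = inner ℂ u v := fun u v => by
    rw [hW.inner_apply_left, neg_neg, hW.apply_neg_apply]
  simp only [smul_interaction_apply,
    hW.apply_neg_apply, inner_add_right, inner_smul_right, inner_smul_left, h4,
    Complex.conj_I]
  ring

end IsEvolutionFamilyVia

/-! ### From weak to strong solutions -/

theorem norm_le_of_dense_inner {S : Set E} (hS : Dense S) {z : E} {K : ℝ} (hK : 0 ≤ K)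
    (h : ∀ v ∈ S, ‖inner ℂ v z‖ ≤ K * ‖v‖) : ‖z‖ ≤ K := by
  have hcl : IsClosed {v : E | ‖inner ℂ v z‖ ≤ K * ‖v‖} :=
    isClosed_le (by fun_prop) (by fun_prop)
  have hz : ‖inner ℂ z z‖ ≤ K * ‖z‖ := hcl.closure_subset_iff.2 h (hS z)
  rw [inner_self_eq_norm_sq_to_K, norm_pow] at hz
  simp only [Complex.coe_algebraMap, Complex.norm_real, norm_norm] at hz
  by_contra! hlt
  nlinarith

/-- Boundedness of `x` makes the pairing with `v` a uniform limit of pairings with elements of `S`.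
-/
theorem continuous_inner_of_dense {S : Set E} (hS : Dense S) {x : ℝ → E} {C : ℝ}
    (hC : ∀ t, ‖x t‖ ≤ C) (h : ∀ v ∈ S, Continuous fun t => inner ℂ (x t) v) (v : E) :
    Continuous fun t => inner ℂ (x t) v := by
  refine continuous_of_uniform_approx_of_continuous fun u hu => ?_
  obtain ⟨ε, hε, hu⟩ := Metric.mem_uniformity_dist.1 hu
  have hC0 : 0 ≤ C := (norm_nonneg _).trans (hC 0)
  obtain ⟨η, hη, hd⟩ := hS.exists_dist_lt v (show 0 < ε / (C + 1) by positivity)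
  refine ⟨_, h η hη, fun t => hu ?_⟩
  rw [dist_eq_norm, ← inner_sub_right]
  rw [dist_eq_norm, lt_div_iff₀ (by positivity)] at hd
  calc ‖inner ℂ (x t) (v - η)‖ ≤ ‖x t‖ * ‖v - η‖ := norm_inner_le_norm _ _
    _ ≤ C * ‖v - η‖ := by gcongr; exact hC t
    _ < ε := by nlinarith [norm_nonneg (v - η)]

/-- A bounded function whose pairings with a dense set are differentiable, with derivative given by
a linear equation, solves that equation in the strong sense. -/
theorem hasDerivAt_of_dense_inner {S : Set E} (hS : Dense S) {N : ℝ → E →L[ℂ] E}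
    (hN : ∀ v, Continuous fun t => N t v) {g y : ℝ → E} (hg : Continuous g) {C : ℝ}
    (hC : ∀ t, ‖y t‖ ≤ C)
    (h : ∀ η ∈ S, ∀ t, HasDerivAt (fun τ => inner ℂ η (y τ)) (inner ℂ η (N t (y t) + g t)) t)
    (t : ℝ) : HasDerivAt y (N t (y t) + g t) t := by
  have hC0 : 0 ≤ C := (norm_nonneg _).trans (hC 0)
  have hy : Continuous y := by
    refine continuous_iff_continuousAt.2 fun s => ?_
    set R := |s| + 1
    have hs : s ∈ Ioo (-R) R := abs_lt.1 (lt_add_one _)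
    obtain ⟨C₁, hC₁0, hC₁⟩ := exists_norm_le_of_strongly_continuous hN R
    obtain ⟨C₂, hC₂⟩ := isCompact_Icc.exists_bound_of_continuousOn (s := Icc (-R) R)
      hg.continuousOn
    have hC₂0 : 0 ≤ C₂ := (norm_nonneg _).trans (hC₂ s (Ioo_subset_Icc_self hs))
    -- The mean value inequality for each scalar pairing has a constant proportional to `‖η‖`; this
    -- uniformity turns weak information into norm continuity.
    have hlip : ∀ r ∈ Icc (-R) R, ‖y r - y s‖ ≤ (C₁ * C + C₂) * ‖r - s‖ := fun r hr => by
      refine norm_le_of_dense_inner hS (by positivity) fun η hη => ?_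
      rw [inner_sub_right]
      refine (Convex.norm_image_sub_le_of_norm_hasDerivWithin_le (s := Icc (-R) R)
        (fun t _ => (h η hη t).hasDerivWithinAt) (C := ‖η‖ * (C₁ * C + C₂))
        (fun t ht => ?_) (convex_Icc _ _) (Ioo_subset_Icc_self hs) hr).trans (le_of_eq (by ring))
      refine (norm_inner_le_norm _ _).trans ?_
      gcongr
      exact (norm_add_le _ _).trans (add_le_add
        ((N t).le_of_opNorm_le_of_le (hC₁ t ht) (hC t)) (hC₂ t ht))
    rw [ContinuousAt, tendsto_iff_norm_sub_tendsto_zero]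
    refine squeeze_zero' (Eventually.of_forall fun _ => norm_nonneg _)
      (g := fun r => (C₁ * C + C₂) * ‖r - s‖) ?_ ?_
    · filter_upwards [Ioo_mem_nhds hs.1 hs.2] with r hr
      exact hlip r (Ioo_subset_Icc_self hr)
    · have : Continuous fun r => (C₁ * C + C₂) * ‖r - s‖ := by fun_prop
      simpa using this.tendsto s
  -- With `y` continuous the right-hand side has a genuine primitive, and `y` minus that primitive
  -- has constant pairing with every `η ∈ S`.
  have hG : ∀ t, HasDerivAt (fun t => y 0 + ∫ τ in (0 : ℝ)..t, (N τ (y τ) + g τ))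
      (N t (y t) + g t) t := fun t =>
    (((continuous_apply_of_strongly_continuous hN hy).add hg).integral_hasStrictDerivAt 0
      t).hasDerivAt.const_add (y 0)
  have heq : y = fun t => y 0 + ∫ τ in (0 : ℝ)..t, (N τ (y τ) + g τ) := by
    funext s
    refine hS.eq_of_inner_right ℂ fun η hη => ?_
    have hd : ∀ t, HasDerivAt (fun t => inner ℂ η (y t) -
        inner ℂ η (y 0 + ∫ τ in (0 : ℝ)..t, (N τ (y τ) + g τ))) 0 t := fun t => by
      have h1 := (h η hη t).sub ((hasDerivAt_const t η).inner ℂ (hG t))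
      rw [inner_zero_left, add_zero, sub_self] at h1
      exact h1
    have hc := is_const_of_deriv_eq_zero (fun t => (hd t).differentiableAt)
      (fun t => (hd t).deriv) s 0
    rw [intervalIntegral.integral_same, add_zero, sub_self] at hc
    exact sub_eq_zero.1 hc
  exact (hG t).congr_of_eventuallyEq (Eventually.of_forall (congrFun heq))

/-! ### Bounded weak solutions are mild -/

namespace IsEvolutionFamilyVia

variable {A : E →ₗ.[ℂ] E} {V W : ℝ → E →L[ℂ] E} {U : ℝ → ℝ → E →L[ℂ] E}

/-- The pairing equals `⟪W τ η, x τ⟫`, with a moving test vector that stays in the domain. The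
product rule then produces two terms in `A` that cancel. -/
theorem hasDerivAt_inner_neg_apply (h : IsEvolutionFamilyVia A V U W)
    (hA : Dense (A.domain : Set E)) {f x : ℝ → E} (hx : IsBoundedWeakSolution A V f x)
    (η : A.domain) (t : ℝ) :
    HasDerivAt (fun τ => inner ℂ (η : E) (W (-τ) (x τ)))
      (inner ℂ (η : E) ((-Complex.I • interaction W V t) (W (-t) (x t)) + W (-t) (f t))) t := by
  obtain ⟨hx, C, hC⟩ := hx
  have hW := h.unitaryGroup
  have hflip : ∀ (ζ : A.domain) t, HasDerivAt (fun τ => inner ℂ (x τ) (ζ : E)) _ t := fun ζ t => by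
    have := (hx ζ t trivial).star
    simpa only [RCLike.star_def, inner_conj_symm] using this
  -- Weak continuity is needed against `W t (A η)`, which need not lie in the domain; this is where
  -- boundedness of `x` enters.
  have hcont := continuous_inner_of_dense hA hC fun η hη =>
    continuous_iff_continuousAt.2 fun t => (hflip ⟨η, hη⟩ t).continuousAt
  obtain ⟨hm, he⟩ := hW.apply_mem_domain t η
  have h1 := hasDerivAt_apply (B := fun τ => innerSL ℂ (x τ)) (C := C)
    (Eventually.of_forall fun τ => by rw [innerSL_apply_norm]; exact hC τ)
    (hcont _).continuousAt (hflip ⟨_, hm⟩ t) (hW.hasDerivAt t η)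
  have h2 := h1.star
  simp only [RCLike.star_def, innerSL_apply_apply, inner_conj_symm, hW.inner_apply_left,
    map_add, he] at h2
  refine h2.congr_deriv ?_
  simp only [smul_interaction_apply, hW.apply_neg_apply, inner_add_right, inner_smul_right,
    inner_smul_left, map_sub, map_mul, map_neg, Complex.conj_I, inner_conj_symm, hW.inner_apply_left,
    neg_neg]
  ring

theorem eq_mild_of_isBoundedWeakSolution (h : IsEvolutionFamilyVia A V U W)
    (hA : Dense (A.domain : Set E)) {f : ℝ → E} (hf : Continuous f) {x : ℝ → E}
    (hx : IsBoundedWeakSolution A V f x) (t : ℝ) :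
    x t = U t 0 (x 0 + ∫ τ in (0 : ℝ)..t, U 0 τ (f τ)) := by
  have hW := h.unitaryGroup
  obtain ⟨C, hC⟩ := hx.2
  have hy : ∀ t, HasDerivAt (fun τ => W (-τ) (x τ))
      ((-Complex.I • interaction W V t) (W (-t) (x t)) + W (-t) (f t)) t :=
    hasDerivAt_of_dense_inner hA h.continuous_smul_interaction
      (g := fun t => W (-t) (f t)) (y := fun t => W (-t) (x t))
      (continuous_apply_of_strongly_continuous hW.continuous_neg hf)
      (fun t => (hW.norm_apply _ _).trans_le (hC t))
      (fun η hη t => h.hasDerivAt_inner_neg_apply hA hx ⟨η, hη⟩ t)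
  have key := linearODE_solution_unique (t₀ := 0) h.continuous_smul_interaction hy
    (h.hasDerivAt_mild hf (x 0)) (by simp [h.apply_self])
  have := congrArg (W t) (congrFun key t)
  simpa only [hW.apply_neg_apply] using this

end IsEvolutionFamilyVia

/-! ### Dichotomies transported to time `0` -/

theorem HasExpDichotomyOn.exists_bound {U : ℝ → ℝ → E →L[ℂ] E} {J : Set ℝ} {P : ℝ → E →L[ℂ] E}
    (hP : HasExpDichotomyOn U J P) (h0 : (0 : ℝ) ∈ J) :
    ∃ M α : ℝ, 0 ≤ M ∧ 0 < α ∧ ∀ t ∈ J, ∀ s ∈ J, s ≤ t → ∀ v,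
      ‖U t s (P s v)‖ ≤ M * Real.exp (-α * (t - s)) * ‖v‖ ∧
      ‖U s t (v - P t v)‖ ≤ M * Real.exp (-α * (t - s)) * ‖v‖ := by
  obtain ⟨M, α, hα, hb⟩ := hP.bound
  refine ⟨M, α, ?_, hα, fun t ht s hs hst v => ⟨?_, ?_⟩⟩
  · have := (norm_nonneg _).trans (hb 0 h0 0 h0 le_rfl).1
    simpa using this
  · exact (U t s * P s).le_of_opNorm_le (hb t ht s hs hst).1 v
  · exact (U s t * (1 - P t)).le_of_opNorm_le (hb t ht s hs hst).2 v

namespace IsEvolutionFamilyVia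

variable {A : E →ₗ.[ℂ] E} {V W : ℝ → E →L[ℂ] E} {U : ℝ → ℝ → E →L[ℂ] E} {P : ℝ → E →L[ℂ] E}

/-- Commutation is available only forward in time, so it is used from `0` to `s` and then inverted
by the cocycle law. The target time `t` is unrestricted. -/
theorem apply_proj_of_nonneg (h : IsEvolutionFamilyVia A V U W)
    (hP : HasExpDichotomyOn U (Ici 0) P) (t : ℝ) {s : ℝ} (hs : 0 ≤ s) (v : E) :
    U t s (P s v) = U t 0 (P 0 (U 0 s v)) := by
  have hc : U s 0 (P 0 (U 0 s v)) = P s (U s 0 (U 0 s v)) :=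
    congrArg (fun T : E →L[ℂ] E => T (U 0 s v)) (hP.comm s hs 0 self_mem_Ici hs)
  rw [h.apply_apply, h.apply_self] at hc
  rw [← hc, h.apply_apply]

theorem apply_proj_of_nonpos (h : IsEvolutionFamilyVia A V U W)
    (hP : HasExpDichotomyOn U (Iic 0) P) (t : ℝ) {s : ℝ} (hs : s ≤ 0) (v : E) :
    U t s (P s v) = U t 0 (P 0 (U 0 s v)) := by
  have hc : U 0 s (P s v) = P 0 (U 0 s v) :=
    congrArg (fun T : E →L[ℂ] E => T v) (hP.comm 0 self_mem_Iic s hs hs)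
  rw [← hc, h.apply_apply]

theorem exists_halfLineDichotomy (h : IsEvolutionFamilyVia A V U W)
    (hP : HasExpDichotomyOn U (Ici 0) P) :
    ∃ M α, 0 ≤ M ∧ HalfLineDichotomy (fun t => U t 0) (fun t => U 0 t) (P 0) M α := by
  obtain ⟨M, α, hM, hα, hb⟩ := hP.exists_bound self_mem_Ici
  refine ⟨M, α, hM, ?_, ?_, ?_, ?_, ?_, hα, ?_, ?_⟩
  · exact fun v => congrArg (fun T : E →L[ℂ] E => T v) (hP.idem 0 self_mem_Ici)
  · exact fun t v => by rw [h.apply_apply, h.apply_self]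
  · exact fun t v => by rw [h.apply_apply, h.apply_self]
  · exact ContinuousLinearMap.ext fun v => h.apply_self 0 v
  · exact ContinuousLinearMap.ext fun v => h.apply_self 0 v
  · intro s t hs hst v
    rw [← h.apply_proj_of_nonneg hP t hs]
    exact (hb t (hs.trans hst) s hs hst v).1
  · intro s t hs hst v
    have := (hb t (hs.trans hst) s hs hst v).2
    rwa [map_sub, h.apply_proj_of_nonneg hP s (hs.trans hst), ← h.apply_apply s 0 t v,
      ← map_sub] at this

/-- Reversing time exchanges the stable and unstable directions, so `1 - P 0` becomes the stable
projection and the results for `[0, ∞)` apply to `(-∞, 0]`. -/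
theorem exists_halfLineDichotomy_reverse (h : IsEvolutionFamilyVia A V U W)
    (hP : HasExpDichotomyOn U (Iic 0) P) :
    ∃ M α, 0 ≤ M ∧ HalfLineDichotomy (fun t => U (-t) 0) (fun t => U 0 (-t)) (1 - P 0) M α := by
  obtain ⟨M, α, hM, hα, hb⟩ := hP.exists_bound self_mem_Iic
  have hidem : ∀ v, P 0 (P 0 v) = P 0 v := fun v =>
    congrArg (fun T : E →L[ℂ] E => T v) (hP.idem 0 self_mem_Iic)
  have hsub : ∀ v, (1 - P 0) v = v - P 0 v := fun _ => rfl
  refine ⟨M, α, hM, ?_, ?_, ?_, ?_, ?_, hα, ?_, ?_⟩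
  · exact fun v => by simp [hsub, hidem]
  · exact fun t v => by rw [h.apply_apply, h.apply_self]
  · exact fun t v => by rw [h.apply_apply, h.apply_self]
  · exact ContinuousLinearMap.ext fun v => by simp [h.apply_self]
  · exact ContinuousLinearMap.ext fun v => by simp [h.apply_self]
  · intro s t hs hst v
    have := (hb (-s) (neg_nonpos.2 hs) (-t) (neg_nonpos.2 (hs.trans hst)) (neg_le_neg hst) v).2
    rwa [map_sub, h.apply_proj_of_nonpos hP _ (neg_nonpos.2 hs), ← h.apply_apply _ 0 (-s) v,
      ← map_sub, ← hsub, neg_sub_neg] at this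
  · intro s t hs hst v
    have := (hb (-s) (neg_nonpos.2 hs) (-t) (neg_nonpos.2 (hs.trans hst)) (neg_le_neg hst) v).1
    rwa [h.apply_proj_of_nonpos hP _ (neg_nonpos.2 (hs.trans hst)), neg_sub_neg,
      ← sub_sub_cancel (U 0 (-t) v) (P 0 _), ← hsub] at this

variable (f : ℝ →ᵇ E)

theorem continuous_pullback (h : IsEvolutionFamilyVia A V U W) :
    Continuous fun t => U 0 t (f t) := h.continuous_apply_comp 0 f.continuous

theorem unstable_eq (h : IsEvolutionFamilyVia A V U W) (hP : HasExpDichotomyOn U (Ici 0) P)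
    (t : ℝ) {s : ℝ} (hs : 0 ≤ s) (v : E) :
    U t s ((1 - P s) v) = U t 0 (U 0 s v - P 0 (U 0 s v)) := by
  have hsub : (1 - P s) v = v - P s v := rfl
  rw [hsub, map_sub, map_sub, h.apply_proj_of_nonneg hP t hs, h.apply_apply]

theorem integrableOn_unstable (h : IsEvolutionFamilyVia A V U W)
    (hP : HasExpDichotomyOn U (Ici 0) P) {t : ℝ} (ht : 0 ≤ t) :
    IntegrableOn (fun τ => U t τ ((1 - P τ) (f τ))) (Ioi t) := by
  obtain ⟨M, α, hM, hd⟩ := h.exists_halfLineDichotomy hP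
  refine (hd.integrableOn_unstable hM (h.continuous_pullback f) f.norm_coe_le_norm ht).congr_fun
    (fun τ hτ => ?_) measurableSet_Ioi
  exact (h.unstable_eq hP t (ht.trans (le_of_lt hτ)) _).symm

theorem integrableOn_unstable_zero (h : IsEvolutionFamilyVia A V U W)
    (hP : HasExpDichotomyOn U (Ici 0) P) :
    IntegrableOn (fun τ => U 0 τ (f τ) - P 0 (U 0 τ (f τ))) (Ioi 0) := by
  obtain ⟨M, α, hM, hd⟩ := h.exists_halfLineDichotomy hP
  exact hd.integrableOn_unstable_zero hM (h.continuous_pullback f) f.norm_coe_le_norm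

theorem unstable_initial_of_bounded (h : IsEvolutionFamilyVia A V U W)
    (hP : HasExpDichotomyOn U (Ici 0) P) {a : E} {C : ℝ}
    (hC : ∀ t, ‖U t 0 (a + ∫ τ in (0 : ℝ)..t, U 0 τ (f τ))‖ ≤ C) :
    a - P 0 a = -∫ τ in Ioi 0, (U 0 τ (f τ) - P 0 (U 0 τ (f τ))) := by
  obtain ⟨M, α, hM, hd⟩ := h.exists_halfLineDichotomy hP
  exact hd.eq_of_bounded hM (h.continuous_pullback f) f.norm_coe_le_norm fun t _ => hC t

theorem exists_norm_mild_le_of_nonneg (h : IsEvolutionFamilyVia A V U W)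
    (hP : HasExpDichotomyOn U (Ici 0) P) {a : E}
    (ha : a - P 0 a = -∫ τ in Ioi 0, (U 0 τ (f τ) - P 0 (U 0 τ (f τ)))) :
    ∃ C, ∀ t, 0 ≤ t → ‖U t 0 (a + ∫ τ in (0 : ℝ)..t, U 0 τ (f τ))‖ ≤ C := by
  obtain ⟨M, α, hM, hd⟩ := h.exists_halfLineDichotomy hP
  exact ⟨_, fun t ht => hd.norm_mild_le hM (h.continuous_pullback f) f.norm_coe_le_norm ha ht⟩

theorem forward_mild_eq (h : IsEvolutionFamilyVia A V U W)
    (hP : HasExpDichotomyOn U (Ici 0) P) (b : E) {t : ℝ} (ht : 0 ≤ t) :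
    (∫ τ in (0 : ℝ)..t, U t τ (P τ (f τ))) - (∫ τ in Ioi t, U t τ ((1 - P τ) (f τ))) + U t 0 b =
      U t 0 ((b - ∫ τ in Ioi 0, (U 0 τ (f τ) - P 0 (U 0 τ (f τ))))
        + ∫ τ in (0 : ℝ)..t, U 0 τ (f τ)) := by
  obtain ⟨M, α, hM, hd⟩ := h.exists_halfLineDichotomy hP
  rw [hd.mild_eq hM (h.continuous_pullback f) f.norm_coe_le_norm ht]
  congr 2
  · refine intervalIntegral.integral_congr fun τ hτ => ?_
    rw [uIcc_of_le ht] at hτ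
    exact h.apply_proj_of_nonneg hP t hτ.1 _
  · refine setIntegral_congr_fun measurableSet_Ioi fun τ hτ => ?_
    exact h.unstable_eq hP t (ht.trans (le_of_lt hτ)) _

/-- The reversed forcing is `-f (-t)`; its sign comes from differentiating `x (-t)`. -/
theorem continuous_pullback_reverse (h : IsEvolutionFamilyVia A V U W) :
    Continuous fun t => U 0 (-t) (-f (-t)) := by
  simp only [map_neg]
  exact ((h.continuous_pullback f).comp continuous_neg).neg

theorem norm_reverse_le (t : ℝ) : ‖-f (-t)‖ ≤ ‖f‖ := by
  rw [norm_neg]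
  exact f.norm_coe_le_norm _

theorem reverse_unstable (v : E) : -v - (1 - P 0) (-v) = -P 0 v := by
  have hsub : (1 - P 0) (-v) = -v - P 0 (-v) := rfl
  rw [hsub, sub_sub_cancel, map_neg]

theorem integral_reverse (U : ℝ → ℝ → E →L[ℂ] E) (t : ℝ) :
    ∫ τ in (0 : ℝ)..t, U 0 (-τ) (-f (-τ)) = ∫ τ in (0 : ℝ)..-t, U 0 τ (f τ) := by
  simp only [map_neg]
  rw [intervalIntegral.integral_neg,
    intervalIntegral.integral_comp_neg (fun τ => U 0 τ (f τ)), neg_zero,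
    ← intervalIntegral.integral_symm]

theorem integral_Ioi_reverse (U : ℝ → ℝ → E →L[ℂ] E) (P : ℝ → E →L[ℂ] E) (t : ℝ) (s : ℝ) :
    ∫ τ in Ioi t, U s 0 (U 0 (-τ) (-f (-τ)) - (1 - P 0) (U 0 (-τ) (-f (-τ)))) =
      -∫ τ in Iic (-t), U s 0 (P 0 (U 0 τ (f τ))) := by
  simp only [map_neg (U 0 _), reverse_unstable]
  simp only [map_neg]
  rw [integral_neg, integral_comp_neg_Ioi t fun τ => U s 0 (P 0 (U 0 τ (f τ)))]

theorem integral_Ioi_zero_reverse (U : ℝ → ℝ → E →L[ℂ] E) (P : ℝ → E →L[ℂ] E) :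
    ∫ τ in Ioi 0, (U 0 (-τ) (-f (-τ)) - (1 - P 0) (U 0 (-τ) (-f (-τ)))) =
      -∫ τ in Iic 0, P 0 (U 0 τ (f τ)) := by
  simp only [map_neg (U 0 _), reverse_unstable]
  rw [integral_neg, integral_comp_neg_Ioi 0 fun τ => P 0 (U 0 τ (f τ)), neg_zero]

theorem integrableOn_stable (h : IsEvolutionFamilyVia A V U W)
    (hP : HasExpDichotomyOn U (Iic 0) P) {t : ℝ} (ht : t ≤ 0) :
    IntegrableOn (fun τ => U t τ (P τ (f τ))) (Iic t) := by
  obtain ⟨M, α, hM, hd⟩ := h.exists_halfLineDichotomy_reverse hP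
  have := (hd.integrableOn_unstable hM (h.continuous_pullback_reverse f) (norm_reverse_le f)
    (neg_nonneg.2 ht)).neg.comp_neg
  rw [integrableOn_Iic_iff_integrableOn_Iio]
  have hset : -Ioi (-t) = Iio t := by ext; simp
  rw [hset] at this
  refine this.congr_fun (fun τ hτ => ?_) measurableSet_Iio
  simp only [Pi.neg_apply, neg_neg, map_neg (U 0 _), reverse_unstable]
  rw [map_neg, neg_neg, h.apply_proj_of_nonpos hP t ((le_of_lt hτ).trans ht)]

theorem integrableOn_stable_zero (h : IsEvolutionFamilyVia A V U W)
    (hP : HasExpDichotomyOn U (Iic 0) P) :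
    IntegrableOn (fun τ => P 0 (U 0 τ (f τ))) (Iic 0) := by
  refine (h.integrableOn_stable f hP le_rfl).congr_fun (fun τ hτ => ?_) measurableSet_Iic
  simp only [h.apply_proj_of_nonpos hP 0 hτ, h.apply_self]

theorem stable_initial_of_bounded (h : IsEvolutionFamilyVia A V U W)
    (hP : HasExpDichotomyOn U (Iic 0) P) {a : E} {C : ℝ}
    (hC : ∀ t, ‖U t 0 (a + ∫ τ in (0 : ℝ)..t, U 0 τ (f τ))‖ ≤ C) :
    P 0 a = ∫ τ in Iic 0, P 0 (U 0 τ (f τ)) := by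
  obtain ⟨M, α, hM, hd⟩ := h.exists_halfLineDichotomy_reverse hP
  have := hd.eq_of_bounded hM (h.continuous_pullback_reverse f) (norm_reverse_le f) (a := a)
    (C := C) fun t _ => by simpa only [integral_reverse] using hC (-t)
  rw [integral_Ioi_zero_reverse, neg_neg] at this
  rw [← this]
  exact (sub_sub_cancel a (P 0 a)).symm

theorem exists_norm_mild_le_of_nonpos (h : IsEvolutionFamilyVia A V U W)
    (hP : HasExpDichotomyOn U (Iic 0) P) {a : E}
    (ha : P 0 a = ∫ τ in Iic 0, P 0 (U 0 τ (f τ))) :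
    ∃ C, ∀ t, t ≤ 0 → ‖U t 0 (a + ∫ τ in (0 : ℝ)..t, U 0 τ (f τ))‖ ≤ C := by
  obtain ⟨M, α, hM, hd⟩ := h.exists_halfLineDichotomy_reverse hP
  refine ⟨M * α⁻¹ * ‖f‖ + M * α⁻¹ * ‖f‖ + M * ‖a‖, fun t ht => ?_⟩
  have := hd.norm_mild_le hM (h.continuous_pullback_reverse f) (norm_reverse_le f) (a := a)
    (by rw [integral_Ioi_zero_reverse, neg_neg, ← ha]; exact sub_sub_cancel a (P 0 a))
    (neg_nonneg.2 ht)
  rwa [integral_reverse, neg_neg] at this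

theorem backward_mild_eq (h : IsEvolutionFamilyVia A V U W)
    (hP : HasExpDichotomyOn U (Iic 0) P) (b : E) {t : ℝ} (ht : t ≤ 0) :
    (∫ τ in Iic t, U t τ (P τ (f τ))) - (∫ τ in t..0, U t τ ((1 - P τ) (f τ))) + U t 0 b =
      U t 0 ((b + ∫ τ in Iic 0, P 0 (U 0 τ (f τ))) + ∫ τ in (0 : ℝ)..t, U 0 τ (f τ)) := by
  obtain ⟨M, α, hM, hd⟩ := h.exists_halfLineDichotomy_reverse hP
  have := hd.mild_eq hM (h.continuous_pullback_reverse f) (norm_reverse_le f) (b := b)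
    (neg_nonneg.2 ht)
  rw [integral_Ioi_zero_reverse, integral_reverse, sub_neg_eq_add] at this
  simp only [neg_neg] at this
  rw [this, integral_Ioi_reverse, sub_neg_eq_add, neg_neg, sub_eq_neg_add]
  congr 2
  · simp only [map_neg]
    rw [intervalIntegral.integral_neg,
      intervalIntegral.integral_comp_neg fun τ => U t 0 ((1 - P 0) (U 0 τ (f τ))), neg_zero,
      neg_neg]
    congr 1
    refine intervalIntegral.integral_congr fun τ hτ => ?_
    rw [uIcc_of_le ht] at hτ
    have hsub : ∀ s v, (1 - P s) v = v - P s v := fun _ _ => rfl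
    simp only [hsub, map_sub, h.apply_proj_of_nonpos hP t hτ.2, h.apply_apply]
  · refine setIntegral_congr_fun measurableSet_Iic fun τ hτ => ?_
    exact h.apply_proj_of_nonpos hP t (hτ.trans ht) _

end IsEvolutionFamilyVia

/-! ### Solvability condition and generalized Green operator -/

theorem matchingOp_apply (Pp Pm : ℝ → E →L[ℂ] E) (v : E) :
    matchingOp Pp Pm v = Pp 0 v - (v - Pm 0 v) := rfl

theorem solvabilityKernel_apply (U : ℝ → ℝ → E →L[ℂ] E) (Pp Pm : ℝ → E →L[ℂ] E) (t : ℝ) (v : E) :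
    solvabilityKernel U Pp Pm t v = projCoker (matchingOp Pp Pm) (Pm 0 (U 0 t v)) := rfl

/-- On the cokernel of `D` the stable projection on `(-∞, 0]` agrees with the unstable projection
on `[0, ∞)`. -/
theorem projCoker_matchingOp_apply {Pp Pm : ℝ → E →L[ℂ] E}
    (hD : IsGeneralizedInvertible (matchingOp Pp Pm)) (v : E) :
    projCoker (matchingOp Pp Pm) (Pm 0 v) = projCoker (matchingOp Pp Pm) (v - Pp 0 v) := by
  rw [← sub_eq_zero, ← map_sub, ← hD.projCoker_apply_apply v, matchingOp_apply]
  congr 1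
  abel

namespace IsEvolutionFamilyVia

variable {A : E →ₗ.[ℂ] E} {V W : ℝ → E →L[ℂ] E} {U : ℝ → ℝ → E →L[ℂ] E}
  {Pp Pm : ℝ → E →L[ℂ] E} (f : ℝ →ᵇ E)

theorem matchingVector_eq (h : IsEvolutionFamilyVia A V U W)
    (hp : HasExpDichotomyOn U (Ici 0) Pp) (hm : HasExpDichotomyOn U (Iic 0) Pm) :
    matchingVector U Pp Pm f 0 = (∫ τ in Ioi 0, (U 0 τ (f τ) - Pp 0 (U 0 τ (f τ)))) +
      ∫ τ in Iic 0, Pm 0 (U 0 τ (f τ)) := by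
  refine congrArg₂ (· + ·) ?_ ?_
  · refine setIntegral_congr_fun measurableSet_Ioi fun τ hτ => ?_
    simp only [h.unstable_eq hp 0 (le_of_lt hτ), h.apply_self]
  · refine setIntegral_congr_fun measurableSet_Iic fun τ hτ => ?_
    simp only [h.apply_proj_of_nonpos hm 0 hτ, h.apply_self]

/-- The dichotomy gives no direct decay for `P₋(0)U(0,t)` when `t > 0`. On the cokernel it may be
replaced by `(I - P₊(0))U(0,t)`, which does decay. -/
theorem integrableOn_Ioi_solvabilityKernel (h : IsEvolutionFamilyVia A V U W)
    (hp : HasExpDichotomyOn U (Ici 0) Pp) (hD : IsGeneralizedInvertible (matchingOp Pp Pm)) :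
    IntegrableOn (fun t => solvabilityKernel U Pp Pm t (f t)) (Ioi 0) := by
  simp only [solvabilityKernel_apply, projCoker_matchingOp_apply hD]
  exact (projCoker (matchingOp Pp Pm)).integrable_comp (h.integrableOn_unstable_zero f hp)

theorem integrableOn_Iic_solvabilityKernel (h : IsEvolutionFamilyVia A V U W)
    (hm : HasExpDichotomyOn U (Iic 0) Pm) :
    IntegrableOn (fun t => solvabilityKernel U Pp Pm t (f t)) (Iic 0) :=
  (projCoker (matchingOp Pp Pm)).integrable_comp (h.integrableOn_stable_zero f hm)

theorem integrable_solvabilityKernel (h : IsEvolutionFamilyVia A V U W)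
    (hp : HasExpDichotomyOn U (Ici 0) Pp) (hm : HasExpDichotomyOn U (Iic 0) Pm)
    (hD : IsGeneralizedInvertible (matchingOp Pp Pm)) :
    Integrable fun t => solvabilityKernel U Pp Pm t (f t) := by
  rw [← integrableOn_univ, ← Iic_union_Ioi (a := (0 : ℝ))]
  exact (h.integrableOn_Iic_solvabilityKernel f hm).union
    (h.integrableOn_Ioi_solvabilityKernel f hp hD)

theorem integral_solvabilityKernel (h : IsEvolutionFamilyVia A V U W)
    (hp : HasExpDichotomyOn U (Ici 0) Pp) (hm : HasExpDichotomyOn U (Iic 0) Pm)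
    (hD : IsGeneralizedInvertible (matchingOp Pp Pm)) :
    ∫ t, solvabilityKernel U Pp Pm t (f t) =
      projCoker (matchingOp Pp Pm) (matchingVector U Pp Pm f 0) := by
  rw [← intervalIntegral.integral_Iic_add_Ioi (h.integrableOn_Iic_solvabilityKernel f hm)
    (h.integrableOn_Ioi_solvabilityKernel f hp hD), h.matchingVector_eq f hp hm, map_add, add_comm]
  congr 1
  · simp only [solvabilityKernel_apply, projCoker_matchingOp_apply hD]
    exact (projCoker _).integral_comp_comm (h.integrableOn_unstable_zero f hp)
  · exact (projCoker _).integral_comp_comm (h.integrableOn_stable_zero f hm)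

theorem greenForward_eq (h : IsEvolutionFamilyVia A V U W)
    (hp : HasExpDichotomyOn U (Ici 0) Pp) {t : ℝ} (ht : 0 ≤ t) :
    greenForward U Pp Pm f t 0 =
      U t 0 ((Pp 0 (pinv (matchingOp Pp Pm) (matchingVector U Pp Pm f 0)) -
        ∫ τ in Ioi 0, (U 0 τ (f τ) - Pp 0 (U 0 τ (f τ)))) + ∫ τ in (0 : ℝ)..t, U 0 τ (f τ)) :=
  h.forward_mild_eq f hp _ ht

theorem greenBackward_eq (h : IsEvolutionFamilyVia A V U W)
    (hm : HasExpDichotomyOn U (Iic 0) Pm) {t : ℝ} (ht : t ≤ 0) :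
    greenBackward U Pp Pm f t 0 =
      U t 0 (((1 - Pm 0) (pinv (matchingOp Pp Pm) (matchingVector U Pp Pm f 0)) +
        ∫ τ in Iic 0, Pm 0 (U 0 τ (f τ))) + ∫ τ in (0 : ℝ)..t, U 0 τ (f τ)) :=
  h.backward_mild_eq f hm _ ht

/-- The initial values of the two branches of the Green operator differ by the solvability
defect. -/
theorem branch_initial_sub (h : IsEvolutionFamilyVia A V U W)
    (hp : HasExpDichotomyOn U (Ici 0) Pp) (hm : HasExpDichotomyOn U (Iic 0) Pm)
    (hD : IsGeneralizedInvertible (matchingOp Pp Pm)) :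
    (Pp 0 (pinv (matchingOp Pp Pm) (matchingVector U Pp Pm f 0)) -
        ∫ τ in Ioi 0, (U 0 τ (f τ) - Pp 0 (U 0 τ (f τ)))) -
      ((1 - Pm 0) (pinv (matchingOp Pp Pm) (matchingVector U Pp Pm f 0)) +
        ∫ τ in Iic 0, Pm 0 (U 0 τ (f τ))) =
      -∫ t, solvabilityKernel U Pp Pm t (f t) := by
  have hsub : ∀ v, (1 - Pm 0) v = v - Pm 0 v := fun _ => rfl
  -- The terms in `D⁺g` combine to `DD⁺g`, and the two integrals combine to `-g`.
  rw [h.integral_solvabilityKernel f hp hm hD, projCoker_apply, matchingOp_apply, hsub]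
  conv_rhs => rw [h.matchingVector_eq f hp hm]
  rw [h.matchingVector_eq f hp hm]
  abel

/-- Reduces the differential equation to two affine conditions on the initial vector, one from each
half-line. -/
theorem isBoundedWeakSolution_iff (h : IsEvolutionFamilyVia A V U W)
    (hA : Dense (A.domain : Set E))
    (hp : HasExpDichotomyOn U (Ici 0) Pp) (hm : HasExpDichotomyOn U (Iic 0) Pm) (x : ℝ → E) :
    IsBoundedWeakSolution A V f x ↔
      ∃ a, a - Pp 0 a = -∫ τ in Ioi 0, (U 0 τ (f τ) - Pp 0 (U 0 τ (f τ))) ∧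
        Pm 0 a = ∫ τ in Iic 0, Pm 0 (U 0 τ (f τ)) ∧
        ∀ t, x t = U t 0 (a + ∫ τ in (0 : ℝ)..t, U 0 τ (f τ)) := by
  constructor
  · intro hx
    have he := h.eq_mild_of_isBoundedWeakSolution hA f.continuous hx
    obtain ⟨C, hC⟩ := hx.2
    have hC' : ∀ t, ‖U t 0 (x 0 + ∫ τ in (0 : ℝ)..t, U 0 τ (f τ))‖ ≤ C := fun t => by
      rw [← he]
      exact hC t
    exact ⟨x 0, h.unstable_initial_of_bounded f hp hC', h.stable_initial_of_bounded f hm hC', he⟩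
  · rintro ⟨a, ha, hb, he⟩
    refine ⟨h.isWeakSolutionOn_of_eventuallyEq f.continuous fun t _ =>
      ⟨a, Eventually.of_forall he⟩, ?_⟩
    obtain ⟨C₁, hC₁⟩ := h.exists_norm_mild_le_of_nonneg f hp ha
    obtain ⟨C₂, hC₂⟩ := h.exists_norm_mild_le_of_nonpos f hm hb
    refine ⟨max C₁ C₂, fun t => ?_⟩
    rw [he]
    rcases le_total 0 t with ht | ht
    · exact (hC₁ t ht).trans (le_max_left _ _)
    · exact (hC₂ t ht).trans (le_max_right _ _)

theorem integral_solvabilityKernel_eq_zero_of_isBoundedWeakSolution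
    (h : IsEvolutionFamilyVia A V U W) (hA : Dense (A.domain : Set E))
    (hp : HasExpDichotomyOn U (Ici 0) Pp) (hm : HasExpDichotomyOn U (Iic 0) Pm)
    (hD : IsGeneralizedInvertible (matchingOp Pp Pm)) {x : ℝ → E}
    (hx : IsBoundedWeakSolution A V f x) :
    ∫ t, solvabilityKernel U Pp Pm t (f t) = 0 := by
  obtain ⟨a, ha, hb, -⟩ := (h.isBoundedWeakSolution_iff f hA hp hm x).1 hx
  -- The two boundedness conditions combine to `Da = g`, so `g` lies in the range of `D`.
  have hg : matchingVector U Pp Pm f 0 = matchingOp Pp Pm a := by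
    rw [h.matchingVector_eq f hp hm, matchingOp_apply, ← hb, ← neg_eq_iff_eq_neg.2 ha]
    abel
  rw [h.integral_solvabilityKernel f hp hm hD, hg, hD.projCoker_apply_apply]

theorem green_of_nonneg (h : IsEvolutionFamilyVia A V U W)
    (hp : HasExpDichotomyOn U (Ici 0) Pp) {t : ℝ} (ht : 0 ≤ t) :
    green U Pp Pm f t 0 =
      U t 0 ((Pp 0 (pinv (matchingOp Pp Pm) (matchingVector U Pp Pm f 0)) -
        ∫ τ in Ioi 0, (U 0 τ (f τ) - Pp 0 (U 0 τ (f τ)))) + ∫ τ in (0 : ℝ)..t, U 0 τ (f τ)) := by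
  rw [green, if_pos ht, h.greenForward_eq f hp ht]

theorem green_of_neg (h : IsEvolutionFamilyVia A V U W)
    (hm : HasExpDichotomyOn U (Iic 0) Pm) {t : ℝ} (ht : t < 0) :
    green U Pp Pm f t 0 =
      U t 0 (((1 - Pm 0) (pinv (matchingOp Pp Pm) (matchingVector U Pp Pm f 0)) +
        ∫ τ in Iic 0, Pm 0 (U 0 τ (f τ))) + ∫ τ in (0 : ℝ)..t, U 0 τ (f τ)) := by
  rw [green, if_neg (not_le.2 ht), h.greenBackward_eq f hm ht.le]

theorem isWeakSolutionOn_green_compl (h : IsEvolutionFamilyVia A V U W)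
    (hp : HasExpDichotomyOn U (Ici 0) Pp) (hm : HasExpDichotomyOn U (Iic 0) Pm) :
    IsWeakSolutionOn A V f (fun t => green U Pp Pm f t 0) {0}ᶜ := by
  refine h.isWeakSolutionOn_of_eventuallyEq f.continuous fun t ht => ?_
  rcases lt_or_gt_of_ne ht with ht | ht
  · exact ⟨_, mem_of_superset (Iio_mem_nhds ht) fun τ hτ => h.green_of_neg f hm hτ⟩
  · exact ⟨_, mem_of_superset (Ioi_mem_nhds ht) fun τ hτ => h.green_of_nonneg f hp (le_of_lt hτ)⟩

theorem exists_tendsto_green (h : IsEvolutionFamilyVia A V U W)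
    (hp : HasExpDichotomyOn U (Ici 0) Pp) (hm : HasExpDichotomyOn U (Iic 0) Pm)
    (hD : IsGeneralizedInvertible (matchingOp Pp Pm)) :
    ∃ a b : E, Tendsto (fun t => green U Pp Pm f t 0) (𝓝[>] 0) (𝓝 a) ∧
      Tendsto (fun t => green U Pp Pm f t 0) (𝓝[<] 0) (𝓝 b) ∧
      a - b = -∫ t, solvabilityKernel U Pp Pm t (f t) := by
  have hlim : ∀ a : E, Tendsto (fun t => U t 0 (a + ∫ τ in (0 : ℝ)..t, U 0 τ (f τ))) (𝓝 0)
      (𝓝 a) := fun a => by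
    simpa [h.apply_self] using (h.continuous_mild f.continuous a).tendsto 0
  refine ⟨_, _, ((hlim _).mono_left nhdsWithin_le_nhds).congr' ?_,
    ((hlim _).mono_left nhdsWithin_le_nhds).congr' ?_, h.branch_initial_sub f hp hm hD⟩
  · filter_upwards [self_mem_nhdsWithin] with t ht
    exact (h.green_of_nonneg f hp (le_of_lt ht)).symm
  · filter_upwards [self_mem_nhdsWithin] with t ht
    exact (h.green_of_neg f hm ht).symm

theorem green_eq_of_solvable (h : IsEvolutionFamilyVia A V U W)
    (hp : HasExpDichotomyOn U (Ici 0) Pp) (hm : HasExpDichotomyOn U (Iic 0) Pm)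
    (hD : IsGeneralizedInvertible (matchingOp Pp Pm))
    (hs : ∫ t, solvabilityKernel U Pp Pm t (f t) = 0) :
    ∃ a₀, a₀ - Pp 0 a₀ = -∫ τ in Ioi 0, (U 0 τ (f τ) - Pp 0 (U 0 τ (f τ))) ∧
      Pm 0 a₀ = ∫ τ in Iic 0, Pm 0 (U 0 τ (f τ)) ∧
      (∀ t, green U Pp Pm f t 0 = U t 0 (a₀ + ∫ τ in (0 : ℝ)..t, U 0 τ (f τ))) ∧
      greenForward U Pp Pm f 0 0 = a₀ ∧ greenBackward U Pp Pm f 0 0 = a₀ := by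
  have heq := h.branch_initial_sub f hp hm hD
  rw [hs, neg_zero, sub_eq_zero] at heq
  have hPp : ∀ v, Pp 0 (Pp 0 v) = Pp 0 v := fun v =>
    congrArg (fun T : E →L[ℂ] E => T v) (hp.idem 0 self_mem_Ici)
  have hPm : ∀ v, Pm 0 (Pm 0 v) = Pm 0 v := fun v =>
    congrArg (fun T : E →L[ℂ] E => T v) (hm.idem 0 self_mem_Iic)
  have hg₁ : Pp 0 (∫ τ in Ioi 0, (U 0 τ (f τ) - Pp 0 (U 0 τ (f τ)))) = 0 := by
    rw [← (Pp 0).integral_comp_comm (h.integrableOn_unstable_zero f hp)]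
    simp [hPp]
  have hg₂ : Pm 0 (∫ τ in Iic 0, Pm 0 (U 0 τ (f τ))) = ∫ τ in Iic 0, Pm 0 (U 0 τ (f τ)) := by
    rw [← (Pm 0).integral_comp_comm (h.integrableOn_stable_zero f hm)]
    simp only [hPm]
  have hsub : ∀ v, (1 - Pm 0) v = v - Pm 0 v := fun _ => rfl
  -- The witness is the forward initial value, from which the condition at `+∞` is read off; its
  -- equality with the backward one gives the condition at `-∞`.
  refine ⟨Pp 0 (pinv (matchingOp Pp Pm) (matchingVector U Pp Pm f 0)) -
    ∫ τ in Ioi 0, (U 0 τ (f τ) - Pp 0 (U 0 τ (f τ))), ?_, ?_, fun t => ?_, ?_, ?_⟩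
  · rw [map_sub, hPp, hg₁]
    abel
  · rw [heq, map_add, hg₂, hsub, map_sub, hPm, sub_self, zero_add]
  · rcases le_or_gt 0 t with ht | ht
    · exact h.green_of_nonneg f hp ht
    · rw [heq]
      exact h.green_of_neg f hm ht
  · rw [h.greenForward_eq f hp le_rfl, h.apply_self, intervalIntegral.integral_same, add_zero]
  · rw [h.greenBackward_eq f hm le_rfl, h.apply_self, intervalIntegral.integral_same, add_zero, heq]

theorem isBoundedWeakSolution_iff_of_solvable (h : IsEvolutionFamilyVia A V U W)
    (hA : Dense (A.domain : Set E))
    (hp : HasExpDichotomyOn U (Ici 0) Pp) (hm : HasExpDichotomyOn U (Iic 0) Pm)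
    (hD : IsGeneralizedInvertible (matchingOp Pp Pm))
    (hs : ∫ t, solvabilityKernel U Pp Pm t (f t) = 0) (x : ℝ → E) :
    IsBoundedWeakSolution A V f x ↔
      ∃ c : E, ∀ t, x t =
        U t 0 (Pp 0 (projKer (matchingOp Pp Pm) c)) + green U Pp Pm f t 0 := by
  obtain ⟨a₀, h₁, h₂, hG, -, -⟩ := h.green_eq_of_solvable f hp hm hD hs
  have hPp : ∀ v, Pp 0 (Pp 0 v) = Pp 0 v := fun v =>
    congrArg (fun T : E →L[ℂ] E => T v) (hp.idem 0 self_mem_Ici)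
  have hPm : ∀ v, Pm 0 (Pm 0 v) = Pm 0 v := fun v =>
    congrArg (fun T : E →L[ℂ] E => T v) (hm.idem 0 self_mem_Iic)
  rw [h.isBoundedWeakSolution_iff f hA hp hm]
  simp only [hG, ← map_add, ← add_assoc]
  constructor
  · rintro ⟨a, ha, hb, hx⟩
    -- The difference lies in `R(P₊) ∩ N(P₋)`, where `D` vanishes, so `c = a - a₀` is fixed by both
    -- projections in the formula.
    have hc₁ : Pp 0 (a - a₀) = a - a₀ := by
      rw [← h₁, sub_eq_sub_iff_add_eq_add] at ha
      rw [map_sub, sub_eq_sub_iff_add_eq_add, add_comm, ← ha.symm, add_comm]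
    have hc₂ : Pm 0 (a - a₀) = 0 := by rw [map_sub, hb, h₂, sub_self]
    have hc₃ : projKer (matchingOp Pp Pm) (a - a₀) = a - a₀ := by
      rw [projKer_apply, matchingOp_apply, hc₁, hc₂, sub_zero, sub_self, map_zero, sub_zero]
    refine ⟨a - a₀, fun t => ?_⟩
    rw [hc₃, hc₁, sub_add_cancel]
    exact hx t
  · rintro ⟨c, hx⟩
    have hc := hD.apply_projKer c
    set w := projKer (matchingOp Pp Pm) c
    -- For `w ∈ N(D)` one has `P₊w = (I - P₋)w`, so adding `P₊w` to `a₀` disturbs neither condition.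
    rw [matchingOp_apply, sub_eq_zero] at hc
    refine ⟨Pp 0 w + a₀, ?_, ?_, hx⟩
    · rw [map_add, hPp, add_sub_add_left_eq_sub, h₁]
    · rw [map_add, hc, map_sub, hPm, sub_self, zero_add, h₂]

end IsEvolutionFamilyVia

end SchrodingerDichotomy

theorem theorem1 {E : Type*} [NormedAddCommGroup E] [InnerProductSpace ℂ E] [CompleteSpace E]
    (H₀ : E →ₗ.[ℂ] E) (hH₀ : IsSelfAdjoint H₀)
    (V : ℝ → E →L[ℂ] E) (hV : ∀ ψ : E, Continuous fun t => V t ψ)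
    (U : ℝ → ℝ → E →L[ℂ] E) (hU : SchrodingerDichotomy.IsEvolutionFamily H₀ V U)
    (Pp Pm : ℝ → E →L[ℂ] E)
    (hp : SchrodingerDichotomy.HasExpDichotomyOn U (Set.Ici 0) Pp)
    (hm : SchrodingerDichotomy.HasExpDichotomyOn U (Set.Iic 0) Pm)
    (hD : SchrodingerDichotomy.IsGeneralizedInvertible (SchrodingerDichotomy.matchingOp Pp Pm))
    (f : ℝ →ᵇ E) :
    -- all improper integrals below converge absolutely
    Integrable (fun t => SchrodingerDichotomy.solvabilityKernel U Pp Pm t (f t)) ∧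
    (∀ t : ℝ, 0 ≤ t → IntegrableOn (fun τ => U t τ ((1 - Pp τ) (f τ))) (Set.Ioi t)) ∧
    (∀ t : ℝ, t ≤ 0 → IntegrableOn (fun τ => U t τ (Pm τ (f τ))) (Set.Iic t)) ∧
    -- solvability
    ((∃ x : ℝ → E, SchrodingerDichotomy.IsBoundedWeakSolution H₀ V f x) ↔
      ∫ t, SchrodingerDichotomy.solvabilityKernel U Pp Pm t (f t) = 0) ∧
    -- the bounded weak solutions, and the equation satisfied by the Green operator
    (∫ t, SchrodingerDichotomy.solvabilityKernel U Pp Pm t (f t) = 0 →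
      (∀ x : ℝ → E, SchrodingerDichotomy.IsBoundedWeakSolution H₀ V f x ↔
        ∃ c : E, ∀ t, x t =
          U t 0 (Pp 0 (SchrodingerDichotomy.projKer (SchrodingerDichotomy.matchingOp Pp Pm) c))
            + SchrodingerDichotomy.green U Pp Pm f t 0) ∧
      SchrodingerDichotomy.greenForward U Pp Pm f 0 0
        = SchrodingerDichotomy.greenBackward U Pp Pm f 0 0 ∧
      SchrodingerDichotomy.IsWeakSolutionOn H₀ V f
        (fun t => SchrodingerDichotomy.green U Pp Pm f t 0) Set.univ) ∧
    -- without the solvability condition: the equation away from `0` and the jump at `0`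
    SchrodingerDichotomy.IsWeakSolutionOn H₀ V f
      (fun t => SchrodingerDichotomy.green U Pp Pm f t 0) {0}ᶜ ∧
    (∃ a b : E,
      Tendsto (fun t => SchrodingerDichotomy.green U Pp Pm f t 0) (𝓝[>] 0) (𝓝 a) ∧
      Tendsto (fun t => SchrodingerDichotomy.green U Pp Pm f t 0) (𝓝[<] 0) (𝓝 b) ∧
      a - b = -∫ t, SchrodingerDichotomy.solvabilityKernel U Pp Pm t (f t)) := by
  obtain ⟨W, hW, hUW⟩ := hU
  have h : SchrodingerDichotomy.IsEvolutionFamilyVia H₀ V U W := ⟨hW, hV, hUW⟩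
  have hA := hH₀.dense_domain
  refine ⟨h.integrable_solvabilityKernel f hp hm hD, fun t ht => h.integrableOn_unstable f hp ht,
    fun t ht => h.integrableOn_stable f hm ht, ⟨?_, fun hs => ?_⟩, fun hs => ⟨?_, ?_, ?_⟩,
    h.isWeakSolutionOn_green_compl f hp hm, h.exists_tendsto_green f hp hm hD⟩
  · rintro ⟨x, hx⟩
    exact h.integral_solvabilityKernel_eq_zero_of_isBoundedWeakSolution f hA hp hm hD hx
  -- The parameter `c = 0` gives the Green function as a bounded solution.
  · exact ⟨_, (h.isBoundedWeakSolution_iff_of_solvable f hA hp hm hD hs _).2 ⟨0, fun _ => rfl⟩⟩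
  · exact h.isBoundedWeakSolution_iff_of_solvable f hA hp hm hD hs
  · obtain ⟨a₀, -, -, -, h₁, h₂⟩ := h.green_eq_of_solvable f hp hm hD hs
    rw [h₁, h₂]
  · obtain ⟨a₀, -, -, hG, -, -⟩ := h.green_eq_of_solvable f hp hm hD hs
    exact h.isWeakSolutionOn_of_eventuallyEq f.continuous fun t _ =>
      ⟨a₀, Filter.Eventually.of_forall hG⟩
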